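/- Let $q\in\mathbb{C}$ with $|q|<1$, and consider Okuyama's spectral curve on $\mathbb{CP}^1$ given by $$x(z)=z+\frac1z,\qquad y(z)=\frac12\Big(z-\frac1z\Big)\prod_{k=1}^\infty\frac{(1-q^kz^2)(1-q^kz^{-2})}{(1-q^k)^2}.$$ The branch points (zeros of $dx$) are $\alpha=\pm1$, with local involution $\sigma(z)=1/z$. Define the correlation differentials $\omega_{g,n}$ ($g\ge0$, $n\ge1$) by topological recursion: $\omega_{0,1}(z_1)=y(z_1)\,dx(z_1)$, $\omega_{0,2}(z_1,z_2)=\frac{dz_1\,dz_2}{(z_1-z_2)^2}$, and, for all other $(g,n)$, with $S=\{2,\dots,n\}$, $$\omega_{g,n}(z_1,z_S)=\sum_{\alpha=\pm1}\operatorname*{Res}_{p=\alpha}K(z_1,p)\Big[\omega_{g-1,n+1}(p,\sigma(p),z_S)+\sum^{\circ}_{\substack{g_1+g_2=g\\ I\sqcup J=S}}\omega_{g_1,|I|+1}(p,z_I)\,\omega_{g_2,|J|+1}(\sigma(p),z_J)\Big],$$ $$K(z_1,p)=\frac12\,\frac{\int_p^{\sigma(p)}\omega_{0,2}(z_1,\cdot)}{\omega_{0,1}(p)-\omega_{0,1}(\sigma(p))},$$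 where the first term in the bracket is absent for $g=0$ and $\circ$ means that the terms containing $\omega_{0,1}$ are excluded. The discrete volumes $N^q_{g,n}(b_1,\dots,b_n)$, for positive integers $b_1,\dots,b_n$, are the coefficients of the expansion near $z_1=\dots=z_n=0$ $$\omega_{g,n}(z_1,\dots,z_n)=\sum_{b_1,\dots,b_n=1}^\infty N^q_{g,n}(b_1,\dots,b_n)\prod_{i=1}^n b_iz_i^{b_i-1}\,dz_i .$$ Let $\zeta_q(2k)=\sum_{m\ge1}\frac{q^{mk}}{(1-q^m)^{2k}}$ for $k\ge1$. Theorem. Let $g\ge0$, $n\ge1$ and $(g,n)\ne(0,1),(0,2)$. There are polynomials $P_\varepsilon\in\mathbb{Q}[B_1,\dots,B_n,Z_1,Z_2,\dots]$, one for each parity class $\varepsilon\in(\mathbb{Z}/2)^n$ and independent of $q$, with the following properties. (i) Give $B_i$ (standing for $b_i^2$) degree $2$ and $Z_k$ (standing for $\zeta_q(2k)$) degree $2k$. Then the maximum over $\varepsilon$ of the total degrees of the nonzero $P_\varepsilon$ is exactly $6g-6+2n$ (in particular, some $P_\varepsilon$ is nonzero). (ii) For every complex $q$ with $|q|<1$,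 the above expansion of $\omega_{g,n}$ near $0$ exists, its coefficients are unique, and for all positive integers $b_1,\dots,b_n$ $$N^q_{g,n}(b_1,\dots,b_n)=P_{(b_1,\dots,b_n)\bmod 2}\big(b_1^2,\dots,b_n^2,\zeta_q(2),\zeta_q(4),\dots\big).$$ (iii) For no such $q$ can $N^q_{g,n}$ be expressed in this way by a family of rational polynomials whose maximal degree is less than $6g-6+2n$. -/

import Mathlib

open Filter Topology

noncomputable section

namespace Okuyama

/-- The residue at `a` of the meromorphic differential `f(p) dp`: the value, for all small enough
radii `r`, of `(2πi)⁻¹ ∮_{|p - a| = r} f(p) dp`. -/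
def residue (f : ℂ → ℂ) (a : ℂ) : ℂ :=
  limUnder (𝓝[>] (0 : ℝ)) fun r : ℝ => (2 * Real.pi * Complex.I)⁻¹ * circleIntegral f a r

/-! ### Topological recursion for a rational spectral curve with `x(z) = z + 1/z`

The bidifferential is `B(z₁, z₂) = dz₁ dz₂ / (z₁ - z₂)²`. The zeros of `dx` are `1` and `-1`, and
near both of them the local involution preserving `x` is `z ↦ 1/z`. Only the behaviour of `y` near
`1` and `-1` enters the stable correlation differentials, so `y` need not be rational. -/

/-- The function `x` of the spectral curve. -/
def xFun (z : ℂ) : ℂ := z + z⁻¹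

/-- The involution `σ` with `x ∘ σ = x`. -/
def sigma (z : ℂ) : ℂ := z⁻¹

/-- The coefficient of `dz` in `ω_{0,1} = y dx`. -/
def omega01 (y : ℂ → ℂ) (z : ℂ) : ℂ := y z * deriv xFun z

/-- The recursion kernel `K(z, p)`, as the coefficient of `dz / dp`:
one half of `∫_p^{σ(p)} ω_{0,2}(z, ·)`, where `1 / (z - p')` is the primitive in `p'` of
`1 / (z - p')²`, over `ω_{0,1}(p) - ω_{0,1}(σ(p))`, where `ω_{0,1}(σ(p))` is a pull-back. -/
def kernel (y : ℂ → ℂ) (z p : ℂ) : ℂ :=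
  (1 / 2) * (1 / (z - sigma p) - 1 / (z - p)) /
    (omega01 y p - omega01 y (sigma p) * deriv sigma p)

/-- The subtuple `z_I` of `z` indexed by `I`, in increasing order of the indices. -/
def subtuple {m : ℕ} (z : Fin m → ℂ) (I : Finset (Fin m)) : Fin I.card → ℂ :=
  fun i => z (I.orderEmbOfFin rfl i)

/-- The correlation differentials of the spectral curve `(z + 1/z, y)`: `omega y g n z` is the
coefficient of `dz₁ ⋯ dzₙ` in `ω_{g,n}(z₁, …, zₙ)`. (There is no `ω_{g,0}`; the value is `0`.)

In the last case `z 0` plays the role of `z₁` and `Fin.tail z` that of `z_S`, `S = {2, …, n}`. The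
two arguments that are put equal to `p` and `σ(p)` contribute `dp` and `σ'(p) dp`. The sum is over
`g₁ + g₂ = g` and `I ⊔ J = S`, without the terms that contain `ω_{0,1}`. -/
def omega (y : ℂ → ℂ) (g n : ℕ) (z : Fin n → ℂ) : ℂ :=
  match n, z with
  | 0, _ => 0
  | m + 1, z =>
    if g = 0 ∧ m = 0 then omega01 y (z 0)
    else if g = 0 ∧ m = 1 then 1 / (z 0 - z (Fin.last m)) ^ 2
    else
      ∑ a ∈ ({1, -1} : Finset ℂ), residue (fun p =>
        kernel y (z 0) p *
          ((if _h : 0 < g then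
              omega y (g - 1) (m + 2) (Fin.cons p (Fin.cons (sigma p) (Fin.tail z))) *
                deriv sigma p
            else 0) +
          ∑ g₁ : Fin (g + 1), ∑ I : Finset (Fin m),
            if _h : ((g₁ : ℕ) = 0 ∧ I = ∅) ∨ (g - (g₁ : ℕ) = 0 ∧ Iᶜ = ∅) then 0
            else
              omega y g₁ (I.card + 1) (Fin.cons p (subtuple (Fin.tail z) I)) *
                (omega y (g - g₁) (Iᶜ.card + 1)
                  (Fin.cons (sigma p) (subtuple (Fin.tail z) Iᶜ)) * deriv sigma p))) a
termination_by 2 * g + n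
decreasing_by
  · omega
  · have h1 := g₁.isLt
    have h2 := Finset.card_add_card_compl I
    rw [Fintype.card_fin] at h2
    rw [← Finset.card_eq_zero, ← Finset.card_eq_zero] at _h
    omega
  · have h1 := g₁.isLt
    have h2 := Finset.card_add_card_compl I
    rw [Fintype.card_fin] at h2
    rw [← Finset.card_eq_zero, ← Finset.card_eq_zero] at _h
    omega

/-! ### Okuyama's discrete volumes -/

/-- The function `y` of Okuyama's spectral curve. -/
def okuyamaY (q z : ℂ) : ℂ :=
  (1 / 2) * (z - z⁻¹) *
    ∏' k : ℕ, (1 - q ^ (k + 1) * z ^ 2) * (1 - q ^ (k + 1) * (z⁻¹) ^ 2) / (1 - q ^ (k + 1)) ^ 2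

/-- `N` is the family of coefficients `N^q_{g,n}(b₁, …, bₙ)` in the expansion at `z = 0`
`ω_{g,n} = ∑_{b₁, …, bₙ ≥ 1} N(b₁, …, bₙ) ∏ bᵢ zᵢ^{bᵢ - 1} dzᵢ` of the correlation differential of
Okuyama's spectral curve. -/
def IsDiscreteVolume (q : ℂ) (g n : ℕ) (N : (Fin n → ℕ+) → ℂ) : Prop :=
  ∀ᶠ z : Fin n → ℂ in 𝓝 0,
    HasSum (fun b : Fin n → ℕ+ => N b * ∏ i, ((b i : ℕ) : ℂ) * z i ^ ((b i : ℕ) - 1))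
      (omega (okuyamaY q) g n z)

/-! ### Quasi-polynomials in `b₁², …, bₙ²` over `ℚ[ζ_q(2), ζ_q(4), …]` -/

/-- The even `q`-zeta value `ζ_q(2k) = ∑_{m ≥ 1} q^{mk} / (1 - q^m)^{2k}`. -/
def qZetaEven (q : ℂ) (k : ℕ) : ℂ :=
  ∑' m : ℕ, q ^ ((m + 1) * k) / (1 - q ^ (m + 1)) ^ (2 * k)

/-- A formal quasi-polynomial: for each parity class, a rational polynomial in the variables
`Sum.inl i`, standing for `bᵢ²`, and `Sum.inr k`, standing for `ζ_q(2(k + 1))`. -/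
abbrev QuasiPoly (n : ℕ) : Type := (Fin n → ZMod 2) → MvPolynomial (Fin n ⊕ ℕ) ℚ

/-- The value of a quasi-polynomial at a tuple of positive integers, for a given `q`. -/
def QuasiPoly.eval {n : ℕ} (P : QuasiPoly n) (q : ℂ) (b : Fin n → ℕ+) : ℂ :=
  MvPolynomial.aeval
    (Sum.elim (fun i => ((b i : ℕ) : ℂ) ^ 2) (fun k => qZetaEven q (k + 1)))
    (P fun i => ((b i : ℕ) : ZMod 2))

/-- The degrees of the variables when `deg bᵢ = 1` and `deg ζ_q(2k) = 2k`. -/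
def weight (n : ℕ) : Fin n ⊕ ℕ → ℕ := Sum.elim (fun _ => 2) (fun k => 2 * (k + 1))

/-- The degree of a quasi-polynomial: the maximum, over the parity classes, of the weighted total
degree (`⊥` for the zero quasi-polynomial). -/
def QuasiPoly.degree {n : ℕ} (P : QuasiPoly n) : WithBot ℕ :=
  Finset.univ.sup fun e => MvPolynomial.weightedTotalDegree' (weight n) (P e)

end Okuyama

end

/-!
The correlation differentials are computed in the local coordinate `r = a x - 2` at the branch
point `a = ±1`. The functions `xi a k z = a (a z)ᵏ / (1 - a z)^(2k + 2)` are, up to the factor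
`dz`, the differentials with a pole of order `2k + 2` at `a` that are odd under the involution `z
↦ 1/z`: in the coordinate, `p * xi a k p = r^(-(k + 1))` at `a`, and `(-1 / (r + 4))^(k + 1)` at
`-a`. At the origin, `xi a k` is the generating series of `a^b` times a polynomial of degree `k`
in `b²` with positive leading coefficient (`hasSum_xi`), so that a linear combination of products
of these functions is the generating series of a quasi-polynomial.

With `s = (z - 1/z)² = r (r + 4)` and `u_m = q^m / (1 - q^m)²`, the infinite product in `y` is `∏
(1 - s u_m)`, and `ζ_q(2k)` is the `k`-th power sum of the `u_m`. The reciprocal of the product,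
which is what the recursion kernel contains, is therefore a power series in `r` whose coefficient
of `r^i` is a rational polynomial of weight at most `i` in `ζ_q(2), ζ_q(4), …`, where `ζ_q(2k)`
has weight `k`. The residues of the recursion are then coefficients of products of power series in
`filteredSeries`, and by induction (`hasExpansion`) `ω_{g,n}` is a linear combination of products
of `n` functions `xi`, where the weight of the coefficient of `∏ xi (a i) (k i)` plus `∑ k i` is
at most `D = 3g + n - 3`. Doubling weights gives the upper bound `6g - 6 + 2n` for the degree.

For the lower bound, the induction also shows that the coefficients with `∑ k i = D`, which are
rational numbers, are non-negative, and that the one with all `a i = 1` and `k = (D, 0, …, 0)` is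
positive. In the class of even tuples the signs `a i` do not matter, so no cancellation is
possible: along the line `b₂ = ⋯ = b_n = 2` the discrete volume is a polynomial in `b₁²` of degree
exactly `D`, whatever the value of `q` (`coeff_restrictLine_ne_zero`). A quasi-polynomial with the
same values has the same restriction to this line, hence degree at least `2 D`.
-/

noncomputable section

namespace Okuyama

/-! ### Residues -/

/-- The circle integrals of `f` over all small circles about `a` exist and equal `2πi R`. -/
def HasResidue (f : ℂ → ℂ) (a R : ℂ) : Prop :=
  ∀ᶠ ρ : ℝ in 𝓝[>] 0, CircleIntegrable f a ρ ∧
    (2 * Real.pi * Complex.I)⁻¹ * circleIntegral f a ρ = R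

theorem HasResidue.residue_eq {f : ℂ → ℂ} {a R : ℂ} (h : HasResidue f a R) : residue f a = R :=
  (tendsto_const_nhds.congr' (h.mono fun _ hρ => hρ.2.symm)).limUnder_eq

theorem HasResidue.add {f g : ℂ → ℂ} {a R S : ℂ} (hf : HasResidue f a R) (hg : HasResidue g a S) :
    HasResidue (fun p => f p + g p) a (R + S) := by
  filter_upwards [hf, hg] with ρ h₁ h₂
  exact ⟨h₁.1.add h₂.1, by rw [circleIntegral.integral_add h₁.1 h₂.1, mul_add, h₁.2, h₂.2]⟩

theorem HasResidue.const_mul {f : ℂ → ℂ} {a R : ℂ} (c : ℂ) (hf : HasResidue f a R) :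
    HasResidue (fun p => c * f p) a (c * R) := by
  filter_upwards [hf] with ρ h
  refine ⟨h.1.const_fun_smul (a := c), ?_⟩
  rw [circleIntegral.integral_const_mul, ← h.2]
  ring

theorem HasResidue.sum {ι : Type*} (s : Finset ι) {f : ι → ℂ → ℂ} {a : ℂ} {R : ι → ℂ}
    (h : ∀ i ∈ s, HasResidue (f i) a (R i)) :
    HasResidue (fun p => ∑ i ∈ s, f i p) a (∑ i ∈ s, R i) := by
  classical
  induction s using Finset.induction_on with
  | empty =>
    refine Eventually.of_forall fun ρ => ?_
    simp [circleIntegral]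
  | insert i s hi ih =>
    simp only [Finset.sum_insert hi]
    exact (h i (Finset.mem_insert_self i s)).add
      (ih fun j hj => h j (Finset.mem_insert_of_mem hj))

/-- What holds near `a`, except perhaps at `a`, holds on all small circles about `a`. -/
theorem eventually_forall_mem_sphere {P : ℂ → Prop} {a : ℂ} (h : ∀ᶠ p in 𝓝[≠] a, P p) :
    ∀ᶠ ρ : ℝ in 𝓝[>] 0, ∀ p ∈ Metric.sphere a |ρ|, P p := by
  obtain ⟨ε, hε, hP⟩ := Metric.eventually_nhds_iff.1 (eventually_nhdsWithin_iff.1 h)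
  filter_upwards [Ioo_mem_nhdsGT hε] with ρ hρ p hp
  rw [Metric.mem_sphere, abs_of_pos hρ.1] at hp
  refine hP (hp ▸ hρ.2) ?_
  rintro rfl
  simp at hp
  exact hρ.1.ne hp

theorem eventually_forall_mem_closedBall {P : ℂ → Prop} {a : ℂ} (h : ∀ᶠ p in 𝓝 a, P p) :
    ∀ᶠ ρ : ℝ in 𝓝[>] 0, ∀ p ∈ Metric.closedBall a ρ, P p := by
  obtain ⟨ε, hε, hP⟩ := Metric.eventually_nhds_iff.1 h
  filter_upwards [Ioo_mem_nhdsGT hε] with ρ hρ p hp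
  exact hP ((Metric.mem_closedBall.1 hp).trans_lt hρ.2)

theorem HasResidue.congr {f g : ℂ → ℂ} {a R : ℂ} (hf : HasResidue f a R)
    (h : ∀ᶠ p in 𝓝[≠] a, f p = g p) : HasResidue g a R := by
  filter_upwards [hf, eventually_forall_mem_sphere h, self_mem_nhdsWithin] with ρ h₁ h₂ hρ
  refine ⟨h₁.1.congr_codiscreteWithin ?_, ?_⟩
  · filter_upwards [self_mem_codiscreteWithin (Metric.sphere a |ρ|)] with p hp
    exact h₂ p hp
  · rw [← h₁.2, circleIntegral.integral_congr (le_of_lt hρ)]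
    intro p hp
    exact (h₂ p (by rwa [abs_of_pos hρ])).symm

theorem hasResidue_of_analyticAt {f : ℂ → ℂ} {a : ℂ} (hf : AnalyticAt ℂ f a) :
    HasResidue f a 0 := by
  filter_upwards [eventually_forall_mem_closedBall hf.eventually_analyticAt, self_mem_nhdsWithin]
    with ρ hρ hpos
  have hd : DifferentiableOn ℂ f (Metric.closedBall a ρ) := fun p hp =>
    (hρ p hp).differentiableAt.differentiableWithinAt
  refine ⟨(hd.continuousOn.mono Metric.sphere_subset_closedBall).circleIntegrable (le_of_lt hpos),
    ?_⟩
  rw [Complex.circleIntegral_eq_zero_of_differentiable_on_off_countable (le_of_lt hpos)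
    Set.countable_empty hd.continuousOn fun p hp =>
      (hρ p (Metric.ball_subset_closedBall hp.1)).differentiableAt, mul_zero]

theorem hasResidue_of_hasDerivAt {F f : ℂ → ℂ} {a : ℂ}
    (hF : ∀ᶠ p in 𝓝[≠] a, HasDerivAt F (f p) p) (hf : ∀ᶠ p in 𝓝[≠] a, ContinuousAt f p) :
    HasResidue f a 0 := by
  filter_upwards [eventually_forall_mem_sphere hF, eventually_forall_mem_sphere hf,
    self_mem_nhdsWithin] with ρ h₁ h₂ hpos
  rw [abs_of_pos hpos] at h₁ h₂
  refine ⟨ContinuousOn.circleIntegrable (le_of_lt hpos)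
    fun p hp => (h₂ p hp).continuousWithinAt, ?_⟩
  rw [circleIntegral.integral_eq_zero_of_hasDerivWithinAt (le_of_lt hpos)
    fun p hp => (h₁ p hp).hasDerivWithinAt, mul_zero]

theorem hasResidue_inv_sub (a : ℂ) : HasResidue (fun p => (p - a)⁻¹) a 1 := by
  filter_upwards [self_mem_nhdsWithin] with ρ hρ
  have hρ : (0 : ℝ) < ρ := hρ
  refine ⟨?_, ?_⟩
  · rw [circleIntegrable_sub_inv_iff]
    right
    simp [abs_of_pos hρ, hρ.ne]
  · rw [circleIntegral.integral_sub_center_inv a hρ.ne', inv_mul_cancel₀ Complex.two_pi_I_ne_zero]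

/-! ### Taylor series of analytic functions at the origin -/

open PowerSeries

/-- The Taylor series of `f` at `0`, as a formal power series. -/
def taylorSeries (f : ℂ → ℂ) : ℂ⟦X⟧ := .mk fun n => iteratedDeriv n f 0 / n.factorial

theorem coeff_taylorSeries (f : ℂ → ℂ) (n : ℕ) :
    coeff n (taylorSeries f) = iteratedDeriv n f 0 / n.factorial := coeff_mk _ _

theorem taylorSeries_congr {f g : ℂ → ℂ} (h : f =ᶠ[𝓝 0] g) : taylorSeries f = taylorSeries g := by
  ext n
  rw [coeff_taylorSeries, coeff_taylorSeries, h.iteratedDeriv_eq]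

theorem taylorSeries_const (c : ℂ) : taylorSeries (fun _ => c) = C c := by
  ext n
  rw [coeff_taylorSeries, coeff_C, iteratedDeriv_const]
  rcases n with _ | n <;> simp

theorem taylorSeries_add {f g : ℂ → ℂ} (hf : AnalyticAt ℂ f 0) (hg : AnalyticAt ℂ g 0) :
    taylorSeries (fun r => f r + g r) = taylorSeries f + taylorSeries g := by
  ext n
  rw [map_add, coeff_taylorSeries, coeff_taylorSeries, coeff_taylorSeries,
    iteratedDeriv_fun_add hf.contDiffAt hg.contDiffAt, add_div]

theorem taylorSeries_mul {f g : ℂ → ℂ} (hf : AnalyticAt ℂ f 0) (hg : AnalyticAt ℂ g 0) :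
    taylorSeries (fun r => f r * g r) = taylorSeries f * taylorSeries g := by
  ext n
  rw [coeff_mul, coeff_taylorSeries, iteratedDeriv_fun_mul hf.contDiffAt hg.contDiffAt,
    Finset.sum_div, Finset.Nat.sum_antidiagonal_eq_sum_range_succ
      (fun i j => coeff i (taylorSeries f) * coeff j (taylorSeries g))]
  refine Finset.sum_congr rfl fun i hi => ?_
  have hi : i ≤ n := Finset.mem_range_succ_iff.1 hi
  rw [coeff_taylorSeries, coeff_taylorSeries, Nat.cast_choose ℂ hi]
  have h1 : (n.factorial : ℂ) ≠ 0 := by exact_mod_cast n.factorial_ne_zero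
  field_simp

theorem taylorSeries_pow {f : ℂ → ℂ} (hf : AnalyticAt ℂ f 0) (n : ℕ) :
    taylorSeries (fun r => f r ^ n) = taylorSeries f ^ n := by
  induction n with
  | zero => simp [taylorSeries_const]
  | succ n ih =>
    simp only [pow_succ]
    rw [taylorSeries_mul (hf.fun_pow n) hf, ih]

theorem taylorSeries_id : taylorSeries (fun r => r) = X := by
  ext n
  rw [coeff_taylorSeries, coeff_X, iteratedDeriv_fun_id_zero]
  split_ifs with h <;> simp [h]

theorem taylorSeries_deriv (f : ℂ → ℂ) :
    taylorSeries (deriv f) = derivative ℂ (taylorSeries f) := by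
  ext n
  rw [coeff_taylorSeries, coeff_derivative, coeff_taylorSeries, iteratedDeriv_succ',
    Nat.factorial_succ]
  have h1 : (n.factorial : ℂ) ≠ 0 := by exact_mod_cast n.factorial_ne_zero
  have h2 : (n + 1 : ℂ) ≠ 0 := by exact_mod_cast n.succ_ne_zero
  push_cast
  field_simp

theorem taylorSeries_eq_of_mul_eq_one {f g : ℂ → ℂ} {φ ψ : ℂ⟦X⟧} (hf : AnalyticAt ℂ f 0)
    (hg : AnalyticAt ℂ g 0) (h : ∀ᶠ r in 𝓝 0, f r * g r = 1) (hφ : taylorSeries f = φ)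
    (hψ : φ * ψ = 1) : taylorSeries g = ψ := by
  have h1 : φ * taylorSeries g = 1 := by
    rw [← hφ, ← taylorSeries_mul hf hg, taylorSeries_congr h, taylorSeries_const, map_one]
  calc taylorSeries g = ψ * φ * taylorSeries g := by rw [mul_comm ψ, hψ, one_mul]
    _ = ψ := by rw [mul_assoc, h1, mul_one]

theorem analyticAt_dslope {f : ℂ → ℂ} (hf : AnalyticAt ℂ f 0) : AnalyticAt ℂ (dslope f 0) 0 :=
  hf.hasFPowerSeriesAt.has_fpower_series_dslope_fslope.analyticAt

theorem eq_add_mul_dslope (f : ℂ → ℂ) (r : ℂ) : f r = f 0 + r * dslope f 0 r := by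
  have := sub_smul_dslope f 0 r
  rw [sub_zero, smul_eq_mul] at this
  rw [this]; ring

theorem taylorSeries_eq_dslope {f : ℂ → ℂ} (hf : AnalyticAt ℂ f 0) :
    taylorSeries f = C (f 0) + X * taylorSeries (dslope f 0) := by
  have hX : AnalyticAt ℂ (fun r : ℂ => r) 0 := by fun_prop
  rw [← taylorSeries_const, ← taylorSeries_id, ← taylorSeries_mul hX (analyticAt_dslope hf),
    ← taylorSeries_add analyticAt_const (hX.fun_mul (analyticAt_dslope hf))]
  exact congrArg _ (funext fun r => eq_add_mul_dslope f r)

theorem coeff_zero_taylorSeries (f : ℂ → ℂ) : coeff 0 (taylorSeries f) = f 0 := by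
  simp [coeff_taylorSeries]

/-- The Taylor series of a function given by a convergent power series. -/
theorem taylorSeries_of_hasSum {f : ℂ → ℂ} {c : ℕ → ℂ}
    (h : ∀ᶠ r in 𝓝 0, HasSum (fun n => c n * r ^ n) (f r)) :
    AnalyticAt ℂ f 0 ∧ taylorSeries f = .mk c := by
  have hp : HasFPowerSeriesAt f (FormalMultilinearSeries.ofScalars ℂ c) 0 := by
    rw [hasFPowerSeriesAt_iff]
    filter_upwards [h] with r hr
    simpa [FormalMultilinearSeries.coeff_ofScalars, mul_comm] using hr
  refine ⟨hp.analyticAt, ?_⟩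
  ext n
  have := hp.eq_formalMultilinearSeries hp.analyticAt.hasFPowerSeriesAt
  have h2 := congrArg (fun P => FormalMultilinearSeries.coeff P n) this
  simp only [FormalMultilinearSeries.coeff_ofScalars] at h2
  rw [coeff_taylorSeries, coeff_mk, h2]

/-- The Taylor series of `f (r (r + 4))`: since `r (r + 4)` vanishes at `0`, the coefficient of `r^i`
involves only the first `i + 1` coefficients of `f`. -/
theorem coeff_taylorSeries_comp {f : ℂ → ℂ} (hf : AnalyticAt ℂ f 0) (i : ℕ) :
    coeff i (taylorSeries fun r => f (r * (r + 4))) =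
      ∑ m ∈ Finset.range (i + 1), coeff m (taylorSeries f) * coeff i ((X * (X + C 4)) ^ m) := by
  have hs : AnalyticAt ℂ (fun r : ℂ => r * (r + 4)) 0 := by fun_prop
  have hTs : taylorSeries (fun r : ℂ => r * (r + 4)) = X * (X + C 4) := by
    rw [taylorSeries_mul (by fun_prop) (by fun_prop), taylorSeries_add (by fun_prop) (by fun_prop),
      taylorSeries_id, taylorSeries_const]
  have key : ∀ M : ℕ, ∀ f : ℂ → ℂ, AnalyticAt ℂ f 0 → ∃ B : ℂ⟦X⟧,
      (taylorSeries fun r => f (r * (r + 4))) =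
        ∑ m ∈ Finset.range M, C (coeff m (taylorSeries f)) * (X * (X + C 4)) ^ m +
          (X * (X + C 4)) ^ M * B := by
    intro M
    induction M with
    | zero => intro f hf; exact ⟨taylorSeries fun r => f (r * (r + 4)), by simp⟩
    | succ M ih =>
      intro f hf
      obtain ⟨B, hB⟩ := ih _ (analyticAt_dslope hf)
      refine ⟨B, ?_⟩
      have hd : AnalyticAt ℂ (fun r => dslope f 0 (r * (r + 4))) 0 :=
        AnalyticAt.fun_comp (by simpa using analyticAt_dslope hf) hs
      have h1 : (taylorSeries fun r => f (r * (r + 4))) = C (f 0) + X * (X + C 4) *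
          taylorSeries (fun r => dslope f 0 (r * (r + 4))) := by
        rw [← hTs, ← taylorSeries_mul hs hd, ← taylorSeries_const,
          ← taylorSeries_add analyticAt_const (hs.fun_mul hd)]
        exact congrArg _ (funext fun r => eq_add_mul_dslope f _)
      have h2 : ∀ m, coeff (m + 1) (taylorSeries f) = coeff m (taylorSeries (dslope f 0)) := by
        intro m
        rw [taylorSeries_eq_dslope hf, map_add, coeff_succ_X_mul, coeff_C, if_neg m.succ_ne_zero,
          zero_add]
      have h3 : ∑ m ∈ Finset.range M, C (coeff m (taylorSeries (dslope f 0))) *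
          (X * (X + C 4)) ^ (m + 1) = X * (X + C 4) * ∑ m ∈ Finset.range M,
            C (coeff m (taylorSeries (dslope f 0))) * (X * (X + C 4)) ^ m := by
        rw [Finset.mul_sum]
        exact Finset.sum_congr rfl fun m _ => by ring
      rw [h1, hB, Finset.sum_range_succ', coeff_zero_taylorSeries]
      simp only [h2]
      rw [h3]
      ring
  obtain ⟨B, hB⟩ := key (i + 1) f hf
  rw [hB, map_add, map_sum, mul_pow, mul_assoc, coeff_X_pow_mul', if_neg (by omega), add_zero]
  exact Finset.sum_congr rfl fun m _ => by rw [coeff_C_mul]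

section BranchCoordinate

/-! ### The local coordinate at a branch point -/

/-- The coordinate `r = a x - 2` on the `x`-line, centred at the branch value `x(a)`, `a = ±1`. As a
function of the uniformizer `p` it is invariant under `p ↦ 1/p` and has a double zero at `a`. -/
def branchCoord (a p : ℂ) : ℂ := a * xFun p - 2

variable {a : ℂ}

theorem ne_zero_of_sq_eq_one (ha : a ^ 2 = 1) : a ≠ 0 := by
  rintro rfl; norm_num at ha

theorem branchCoord_eq (ha : a ^ 2 = 1) {p : ℂ} (hp : p ≠ 0) :
    branchCoord a p = a * (p - a) ^ 2 / p := by
  rw [branchCoord, xFun, eq_div_iff hp]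
  field_simp
  linear_combination (2 * p - a) * ha

theorem branchCoord_self (ha : a ^ 2 = 1) : branchCoord a a = 0 := by
  rw [branchCoord_eq ha (ne_zero_of_sq_eq_one ha)]; simp

theorem branchCoord_add_four (ha : a ^ 2 = 1) {p : ℂ} (hp : p ≠ 0) :
    branchCoord a p + 4 = a * (p + a) ^ 2 / p := by
  rw [branchCoord_eq ha hp, eq_div_iff hp, add_mul, div_mul_cancel₀ _ hp]
  linear_combination (-4 * p) * ha

theorem branchCoord_mul (ha : a ^ 2 = 1) {p : ℂ} (hp : p ≠ 0) :
    branchCoord a p * (branchCoord a p + 4) = (p - p⁻¹) ^ 2 := by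
  rw [branchCoord_add_four ha hp, branchCoord_eq ha hp]
  have : a ^ 2 * ((p - a) * (p + a)) ^ 2 = (p ^ 2 - 1) ^ 2 := by
    rw [show (p - a) * (p + a) = p ^ 2 - a ^ 2 by ring, ha, one_mul]
  field_simp
  linear_combination this

/-- Punctured neighbourhoods of a branch point avoid the origin and both branch points. -/
theorem eventually_ne_branch (ha : a ^ 2 = 1) : ∀ᶠ p in 𝓝[≠] a, p ≠ 0 ∧ p ^ 2 ≠ 1 := by
  have h0 := ne_zero_of_sq_eq_one ha
  have h1 : ∀ᶠ p : ℂ in 𝓝[≠] a, p ≠ 0 := (eventually_ne_nhds h0).filter_mono nhdsWithin_le_nhds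
  have h2 : ∀ᶠ p : ℂ in 𝓝[≠] a, p ≠ -a :=
    (eventually_ne_nhds (self_ne_neg.2 h0)).filter_mono nhdsWithin_le_nhds
  filter_upwards [h1, h2, self_mem_nhdsWithin] with p h1 h2 h3
  refine ⟨h1, fun h => ?_⟩
  rcases sq_eq_sq_iff_eq_or_eq_neg.1 (h.trans ha.symm) with h | h
  · exact h3 h
  · exact h2 h

theorem branchCoord_ne_zero (ha : a ^ 2 = 1) {p : ℂ} (hp : p ≠ 0) (hp1 : p ^ 2 ≠ 1) :
    branchCoord a p ≠ 0 := by
  rw [branchCoord_eq ha hp]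
  have h : p - a ≠ 0 := fun h => hp1 (by rw [sub_eq_zero.1 h, ha])
  have h0 := ne_zero_of_sq_eq_one ha
  positivity

theorem branchCoord_add_four_ne_zero (ha : a ^ 2 = 1) {p : ℂ} (hp : p ≠ 0) (hp1 : p ^ 2 ≠ 1) :
    branchCoord a p + 4 ≠ 0 := by
  rw [branchCoord_add_four ha hp]
  have h : p + a ≠ 0 := fun h => hp1 (by rw [add_eq_zero_iff_eq_neg.1 h, neg_sq, ha])
  have h0 := ne_zero_of_sq_eq_one ha
  positivity

theorem hasDerivAt_xFun {p : ℂ} (hp : p ≠ 0) : HasDerivAt xFun (1 - (p ^ 2)⁻¹) p := by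
  have h := (hasDerivAt_id p).add (hasDerivAt_inv hp)
  rw [← sub_eq_add_neg] at h
  exact h

theorem hasDerivAt_branchCoord (a : ℂ) {p : ℂ} (hp : p ≠ 0) :
    HasDerivAt (branchCoord a) (a * (1 - (p ^ 2)⁻¹)) p :=
  ((hasDerivAt_xFun hp).const_mul a).sub_const 2

theorem analyticAt_branchCoord (a : ℂ) {p : ℂ} (hp : p ≠ 0) : AnalyticAt ℂ (branchCoord a) p :=
  (analyticAt_const.mul (analyticAt_id.add (analyticAt_inv hp))).sub analyticAt_const

theorem tendsto_branchCoord (ha : a ^ 2 = 1) : Tendsto (branchCoord a) (𝓝 a) (𝓝 0) := by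
  have := (analyticAt_branchCoord a (ne_zero_of_sq_eq_one ha)).continuousAt.tendsto
  rwa [branchCoord_self ha] at this

theorem hasResidue_pow_branchCoord (ha : a ^ 2 = 1) (M : ℕ) :
    HasResidue (fun p => (branchCoord a p ^ (M + 1))⁻¹ * (a * (1 - (p ^ 2)⁻¹))) a
      (if M = 0 then 2 else 0) := by
  have h0 := ne_zero_of_sq_eq_one ha
  rcases M with _ | M
  · -- the logarithmic derivative of `a (p - a)² / p`
    have h := ((hasResidue_inv_sub a).const_mul 2).add
      ((hasResidue_of_analyticAt (analyticAt_inv h0)).const_mul (-1))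
    simp only [mul_one, mul_zero, add_zero] at h
    refine h.congr ?_
    filter_upwards [eventually_ne_branch ha, self_mem_nhdsWithin] with p ⟨hp, hp1⟩ hpa
    have hpa : p - a ≠ 0 := sub_ne_zero.2 hpa
    rw [zero_add, pow_one, branchCoord_eq ha hp]
    field_simp
    linear_combination (-1 : ℂ) * ha
  · refine hasResidue_of_hasDerivAt
      (F := fun p => -((M + 1 : ℕ) : ℂ)⁻¹ * (branchCoord a p ^ (M + 1))⁻¹) ?_ ?_
    · filter_upwards [eventually_ne_branch ha] with p ⟨hp, hp1⟩
      have hr := branchCoord_ne_zero ha hp hp1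
      refine ((((hasDerivAt_branchCoord a hp).fun_pow (M + 1)).fun_inv
        (pow_ne_zero _ hr)).const_mul (-((M + 1 : ℕ) : ℂ)⁻¹)).congr_deriv ?_
      have hM : ((M + 1 : ℕ) : ℂ) ≠ 0 := by exact_mod_cast M.succ_ne_zero
      rw [Nat.add_sub_cancel]
      generalize a * (1 - (p ^ 2)⁻¹) = d
      field_simp
      ring
    · filter_upwards [eventually_ne_branch ha] with p ⟨hp, hp1⟩
      have hr := branchCoord_ne_zero ha hp hp1
      have hc := (analyticAt_branchCoord a hp).continuousAt
      have : p ^ 2 ≠ 0 := pow_ne_zero _ hp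
      fun_prop (disch := first | assumption | exact pow_ne_zero _ hr)

/-- A residue at a branch point computed in the coordinate `r`, which has a double zero there. -/
theorem hasResidue_comp_branchCoord (ha : a ^ 2 = 1) (M : ℕ) {ψ : ℂ → ℂ} (hψ : AnalyticAt ℂ ψ 0) :
    HasResidue (fun p => ψ (branchCoord a p) * (branchCoord a p ^ (M + 1))⁻¹ *
      (a * (1 - (p ^ 2)⁻¹))) a (2 * coeff M (taylorSeries ψ)) := by
  have h0 := ne_zero_of_sq_eq_one ha
  have hana : ∀ {ψ : ℂ → ℂ}, AnalyticAt ℂ ψ 0 →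
      AnalyticAt ℂ (fun p => ψ (branchCoord a p) * (a * (1 - (p ^ 2)⁻¹))) a := fun {ψ} hψ =>
    (AnalyticAt.fun_comp (by rwa [branchCoord_self ha]) (analyticAt_branchCoord a h0)).fun_mul
      (by fun_prop (disch := exact pow_ne_zero _ h0))
  induction M generalizing ψ with
  | zero =>
    have h := ((hasResidue_pow_branchCoord ha 0).const_mul (ψ 0)).add
      (hasResidue_of_analyticAt (hana (analyticAt_dslope hψ)))
    rw [if_pos rfl, add_zero] at h
    rw [coeff_zero_taylorSeries, mul_comm]
    refine h.congr ?_
    filter_upwards [eventually_ne_branch ha] with p ⟨hp, hp1⟩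
    have hr := branchCoord_ne_zero ha hp hp1
    rw [eq_add_mul_dslope ψ (branchCoord a p)]
    field_simp
    ring
  | succ M ih =>
    have h := ((hasResidue_pow_branchCoord ha (M + 1)).const_mul (ψ 0)).add
      (ih (analyticAt_dslope hψ))
    rw [if_neg M.succ_ne_zero, mul_zero, zero_add] at h
    rw [taylorSeries_eq_dslope hψ, map_add, coeff_succ_X_mul, coeff_C, if_neg M.succ_ne_zero,
      zero_add]
    refine h.congr ?_
    filter_upwards [eventually_ne_branch ha] with p ⟨hp, hp1⟩
    have hr := branchCoord_ne_zero ha hp hp1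
    rw [eq_add_mul_dslope ψ (branchCoord a p)]
    field_simp
    ring

end BranchCoordinate

section ZetaValues

/-! ### Polynomials of bounded weighted degree -/

section Degree

variable {σ : Type*}

/-- The polynomials of weighted degree at most `d`. -/
def degLE (w : σ → ℕ) (d : ℕ) : Submodule ℚ (MvPolynomial σ ℚ) where
  carrier := {p | ∀ m ∈ p.support, Finsupp.weight w m ≤ d}
  zero_mem' := by simp
  add_mem' := by
    classical
    intro p q hp hq m hm
    rcases Finset.mem_union.1 (MvPolynomial.support_add hm) with h | h
    exacts [hp m h, hq m h]
  smul_mem' c p hp m hm := hp m (MvPolynomial.support_smul hm)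

theorem mem_degLE {w : σ → ℕ} {d : ℕ} {p : MvPolynomial σ ℚ} :
    p ∈ degLE w d ↔ ∀ m ∈ p.support, Finsupp.weight w m ≤ d := Iff.rfl

theorem degLE_mono {w : σ → ℕ} {d e : ℕ} (h : d ≤ e) {p : MvPolynomial σ ℚ} (hp : p ∈ degLE w d) :
    p ∈ degLE w e := fun m hm => (hp m hm).trans h

theorem mul_mem_degLE {w : σ → ℕ} {d e : ℕ} {p q : MvPolynomial σ ℚ} (hp : p ∈ degLE w d)
    (hq : q ∈ degLE w e) : p * q ∈ degLE w (d + e) := by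
  classical
  intro m hm
  obtain ⟨a, ha, b, hb, rfl⟩ := Finset.mem_add.1 (MvPolynomial.support_mul p q hm)
  rw [map_add]
  exact add_le_add (hp a ha) (hq b hb)

theorem C_mem_degLE (w : σ → ℕ) (d : ℕ) (c : ℚ) : MvPolynomial.C c ∈ degLE w d := by
  classical
  intro m hm
  have : m = 0 := by
    by_contra h
    exact (MvPolynomial.mem_support_iff.1 hm) (by rw [MvPolynomial.coeff_C, if_neg (Ne.symm h)])
  simp [this]

theorem X_mem_degLE (w : σ → ℕ) (i : σ) : MvPolynomial.X i ∈ degLE w (w i) := by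
  intro m hm
  rw [MvPolynomial.support_X, Finset.mem_singleton] at hm
  simp [hm, Finsupp.weight_single]

end Degree

/-! ### The infinite product -/

/-- Rational polynomials in the even `q`-zeta values; the variable `k` stands for
`ζ_q(2(k + 1))`. -/
abbrev ZetaPoly : Type := MvPolynomial ℕ ℚ

/-- Half the weight of the `q`-zeta values. -/
def zetaWeight (k : ℕ) : ℕ := k + 1

/-- Evaluation of a polynomial in the `q`-zeta values. -/
def zetaEval (q : ℂ) : ZetaPoly →ₐ[ℚ] ℂ := MvPolynomial.aeval fun k => qZetaEven q (k + 1)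

/-- Power series in `r` over `ZetaPoly` whose coefficient of `r^i` has weight at most `i`. -/
def filteredSeries : Subring ZetaPoly⟦X⟧ where
  carrier := {φ | ∀ i, coeff i φ ∈ degLE zetaWeight i}
  zero_mem' i := by simp
  one_mem' i := by
    rw [coeff_one]
    split_ifs
    · exact map_one (MvPolynomial.C (σ := ℕ) (R := ℚ)) ▸ C_mem_degLE _ _ _
    · exact zero_mem _
  add_mem' hφ hψ i := by rw [map_add]; exact add_mem (hφ i) (hψ i)
  neg_mem' hφ i := by rw [map_neg]; exact neg_mem (hφ i)
  mul_mem' hφ hψ i := by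
    rw [coeff_mul]
    refine Submodule.sum_mem _ fun x hx => ?_
    rw [← Finset.HasAntidiagonal.mem_antidiagonal.1 hx]
    exact mul_mem_degLE (hφ _) (hψ _)

theorem X_mem_filteredSeries : (X : ZetaPoly⟦X⟧) ∈ filteredSeries := fun i => by
  rw [coeff_X]
  split_ifs
  · exact map_one (MvPolynomial.C (σ := ℕ) (R := ℚ)) ▸ C_mem_degLE _ _ _
  · exact zero_mem _

theorem C_mem_filteredSeries (c : ℚ) :
    C (MvPolynomial.C c : ZetaPoly) ∈ filteredSeries := fun i => by
  rw [coeff_C]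
  split_ifs
  · exact C_mem_degLE _ _ _
  · exact zero_mem _

/-- The complete homogeneous symmetric polynomials, expressed through the power sums by Newton's
identities `(m + 1) h_{m+1} = ∑ p_{i+1} h_{m-i}`. -/
def completeHomogeneous : ℕ → ZetaPoly
  | 0 => 1
  | m + 1 => MvPolynomial.C (m + 1 : ℚ)⁻¹ *
      ∑ i : Fin (m + 1), MvPolynomial.X (i : ℕ) * completeHomogeneous (m - i)

theorem completeHomogeneous_mem_degLE (m : ℕ) :
    completeHomogeneous m ∈ degLE zetaWeight m := by
  induction m using Nat.strong_induction_on with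
  | _ m ih =>
    rcases m with _ | m
    · rw [completeHomogeneous]
      exact map_one (MvPolynomial.C (σ := ℕ) (R := ℚ)) ▸ C_mem_degLE _ _ _
    · rw [completeHomogeneous, ← zero_add (m + 1)]
      refine mul_mem_degLE (C_mem_degLE _ _ _) (Submodule.sum_mem _ fun i _ => ?_)
      refine degLE_mono ?_ (mul_mem_degLE (X_mem_degLE _ _) (ih (m - i) (by omega)))
      simp only [zetaWeight]
      omega

/-- The numbers `q^{k+1} / (1 - q^{k+1})²` whose power sums are the `q`-zeta values. -/
def node (q : ℂ) (k : ℕ) : ℂ := q ^ (k + 1) / (1 - q ^ (k + 1)) ^ 2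

theorem qZetaEven_eq (q : ℂ) (k : ℕ) : qZetaEven q k = ∑' m, node q m ^ k := by
  simp only [qZetaEven, node, div_pow, ← pow_mul]

variable {q : ℂ}

theorem norm_pow_succ_lt_one (hq : ‖q‖ < 1) (k : ℕ) : ‖q ^ (k + 1)‖ < 1 := by
  rw [norm_pow]
  exact pow_lt_one₀ (norm_nonneg q) hq k.succ_ne_zero

theorem one_sub_pow_ne_zero (hq : ‖q‖ < 1) (k : ℕ) : 1 - q ^ (k + 1) ≠ 0 := fun h => by
  have := norm_pow_succ_lt_one hq k
  rw [← sub_eq_zero.1 h, norm_one] at this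
  exact lt_irrefl _ this

theorem summable_norm_node (hq : ‖q‖ < 1) : Summable fun k => ‖node q k‖ := by
  have h0 : 0 < 1 - ‖q‖ := sub_pos.2 hq
  refine Summable.of_nonneg_of_le (fun k => norm_nonneg _) (fun k => ?_)
    (((summable_geometric_of_lt_one (norm_nonneg q) hq).mul_left ((1 - ‖q‖) ^ 2)⁻¹))
  have h1 : 1 - ‖q‖ ≤ ‖1 - q ^ (k + 1)‖ := by
    have h2 := norm_sub_norm_le (1 : ℂ) (q ^ (k + 1))
    have h3 : ‖q ^ (k + 1)‖ ≤ ‖q‖ := by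
      rw [norm_pow]
      exact pow_le_of_le_one (norm_nonneg q) hq.le k.succ_ne_zero
    rw [norm_one] at h2
    linarith
  rw [node, norm_div, norm_pow, norm_pow, inv_mul_eq_div]
  refine div_le_div₀ (by positivity) ?_ (by positivity) (pow_le_pow_left₀ h0.le h1 2)
  exact pow_le_pow_of_le_one (norm_nonneg q) hq.le k.le_succ

/-- Minus the logarithm of the product `∏ (1 - s uₖ)` has the power sums of the `uₖ`, divided by
`n`, as its Taylor coefficients. -/
theorem hasSum_neg_log_product (hq : ‖q‖ < 1) : ∀ᶠ s : ℂ in 𝓝 0,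
    HasSum (fun n : ℕ => qZetaEven q n / n * s ^ n)
      (-∑' k, Complex.log (1 - s * node q k)) ∧
    Complex.exp (∑' k, Complex.log (1 - s * node q k)) = ∏' k, (1 - s * node q k) := by
  have hu := summable_norm_node hq
  set U := ∑' k, ‖node q k‖ with hU
  have hU0 : 0 ≤ U := tsum_nonneg fun k => norm_nonneg _
  have hle : ∀ k, ‖node q k‖ ≤ U := fun k => hu.le_tsum k fun j _ => norm_nonneg _
  filter_upwards [Metric.ball_mem_nhds (0 : ℂ) (inv_pos.2 (add_pos_of_nonneg_of_pos hU0 one_pos))]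
    with s hs
  rw [mem_ball_zero_iff, ← one_div, lt_div_iff₀ (by positivity)] at hs
  set ρ := ‖s‖ * (U + 1)
  have hρ0 : 0 ≤ ρ := by positivity
  have hsu : ∀ k, ‖s * node q k‖ ≤ ρ := fun k => by
    rw [norm_mul]
    exact mul_le_mul_of_nonneg_left ((hle k).trans (by linarith)) (norm_nonneg s)
  have hlt : ∀ k, ‖s * node q k‖ < 1 := fun k => (hsu k).trans_lt hs
  have hrow : ∀ k, HasSum (fun n : ℕ => (s * node q k) ^ n / n)
      (-Complex.log (1 - s * node q k)) := fun k => Complex.hasSum_taylorSeries_neg_log (hlt k)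
  have hsum : Summable fun x : ℕ × ℕ => (s * node q x.1) ^ x.2 / x.2 := by
    have hg : Summable fun n : ℕ => ρ ^ (n - 1) :=
      (summable_nat_add_iff 1).1 (by simpa using summable_geometric_of_lt_one hρ0 hs)
    refine Summable.of_norm_bounded (Summable.mul_of_nonneg (hu.mul_left ‖s‖) hg
      (fun k => by positivity) (fun n => by positivity)) ?_
    rintro ⟨k, n⟩
    rcases n with _ | n
    · simp; positivity
    · have h1 : (1 : ℝ) ≤ ((n + 1 : ℕ) : ℝ) := by exact_mod_cast Nat.le_add_left 1 n
      rw [norm_div, Complex.norm_natCast, norm_pow, pow_succ', Nat.add_sub_cancel, ← norm_mul]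
      refine (div_le_self (by positivity) h1).trans ?_
      exact mul_le_mul_of_nonneg_left (pow_le_pow_left₀ (norm_nonneg _) (hsu k) n) (norm_nonneg _)
  have hlog := (hsum.hasSum.prod_fiberwise hrow)
  have hswap := ((Equiv.prodComm ℕ ℕ).hasSum_iff.2 hsum.hasSum).prod_fiberwise
    (fun n => (((Equiv.prodComm ℕ ℕ).summable_iff.2 hsum).prod_factor n).hasSum)
  refine ⟨?_, ?_⟩
  · rw [← tsum_neg, hlog.tsum_eq]
    refine hswap.congr_fun fun n => ?_
    simp only [Function.comp_apply, Equiv.prodComm_apply, Prod.swap_prod_mk, mul_pow]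
    rw [qZetaEven_eq, tsum_div_const, tsum_mul_left]
    ring
  · refine Complex.cexp_tsum_eq_tprod (fun k h => ?_) ?_
    · have := hlt k
      rw [← sub_eq_zero.1 h, norm_one] at this
      exact lt_irrefl _ this
    · exact (summable_neg_iff).1 hlog.summable

/-- The inverse `1 / ∏ (1 - s uₖ)` of the product in Okuyama's spectral curve. -/
def invProduct (q s : ℂ) : ℂ := (∏' k, (1 - s * node q k))⁻¹

theorem analyticAt_invProduct (hq : ‖q‖ < 1) : AnalyticAt ℂ (invProduct q) 0 ∧
    ∀ m, coeff m (taylorSeries (invProduct q)) = zetaEval q (completeHomogeneous m) := by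
  set G : ℂ → ℂ := fun s => -∑' k, Complex.log (1 - s * node q k) with hG
  obtain ⟨hGa, hGT⟩ := taylorSeries_of_hasSum ((hasSum_neg_log_product hq).mono fun s h => h.1)
  have heq : invProduct q =ᶠ[𝓝 0] fun s => Complex.exp (G s) := by
    filter_upwards [hasSum_neg_log_product hq] with s hs
    rw [invProduct, ← hs.2, hG, Complex.exp_neg]
  have hEa : AnalyticAt ℂ (fun s => Complex.exp (G s)) 0 := hGa.cexp
  refine ⟨hEa.congr heq.symm, ?_⟩
  rw [taylorSeries_congr heq]
  have hode : derivative ℂ (taylorSeries fun s => Complex.exp (G s)) =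
      derivative ℂ (taylorSeries G) * taylorSeries fun s => Complex.exp (G s) := by
    rw [← taylorSeries_deriv, ← taylorSeries_deriv, ← taylorSeries_mul hGa.deriv hEa]
    refine taylorSeries_congr ?_
    filter_upwards [hGa.eventually_analyticAt] with s hs
    rw [hs.differentiableAt.hasDerivAt.cexp.deriv, mul_comm]
  intro m
  induction m using Nat.strong_induction_on with
  | _ m ih =>
    rcases m with _ | m
    · rw [coeff_zero_taylorSeries, completeHomogeneous, map_one]
      simp [hG]
    · have h1 := congrArg (coeff m) hode
      rw [coeff_derivative, coeff_mul, Finset.Nat.sum_antidiagonal_eq_sum_range_succ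
        (fun i j => coeff i (derivative ℂ (taylorSeries G)) *
          coeff j (taylorSeries fun s => Complex.exp (G s)))] at h1
      have hm : (m + 1 : ℂ) ≠ 0 := by exact_mod_cast m.succ_ne_zero
      refine mul_right_cancel₀ hm (h1.trans ?_)
      rw [completeHomogeneous, map_mul, map_sum, ← MvPolynomial.algebraMap_eq, AlgHom.commutes,
        eq_ratCast, Fin.sum_univ_eq_sum_range
        (fun i => zetaEval q (MvPolynomial.X i * completeHomogeneous (m - i)))]
      push_cast
      rw [mul_assoc, mul_comm, mul_assoc, mul_inv_cancel₀ hm, mul_one]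
      refine Finset.sum_congr rfl fun i hi => ?_
      rw [ih (m - i) (by omega), map_mul, coeff_derivative, hGT, coeff_mk, zetaEval,
        MvPolynomial.aeval_X]
      have hi1 : (i + 1 : ℂ) ≠ 0 := by exact_mod_cast i.succ_ne_zero
      push_cast
      rw [div_mul_cancel₀ _ hi1]

/-! ### The formal power series in the recursion kernel -/

/-- The Taylor series in `r` of `1 / ∏ (1 - s uₖ)`, where `s = r (r + 4)`. -/
def invProductSeries : ZetaPoly⟦X⟧ := .mk fun i =>
  ∑ m ∈ Finset.range (i + 1), completeHomogeneous m *
    coeff i ((X * (X + C (MvPolynomial.C 4))) ^ m : ZetaPoly⟦X⟧)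

/-- The power series of `1 / (r + 4)`. -/
def invAddFour : ZetaPoly⟦X⟧ := .mk fun i => MvPolynomial.C ((-1) ^ i / 4 ^ (i + 1))

theorem invProductSeries_mem : invProductSeries ∈ filteredSeries := by
  intro i
  rw [invProductSeries, coeff_mk]
  refine Submodule.sum_mem _ fun m hm => ?_
  have hm : m ≤ i := Finset.mem_range_succ_iff.1 hm
  have h : (X + C (MvPolynomial.C 4)) ^ m ∈ filteredSeries :=
    pow_mem (add_mem X_mem_filteredSeries (C_mem_filteredSeries 4)) m
  rw [mul_pow, coeff_X_pow_mul', if_pos hm]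
  have := mul_mem_degLE (completeHomogeneous_mem_degLE m) (h (i - m))
  rwa [Nat.add_sub_cancel' hm] at this

theorem invAddFour_mem : invAddFour ∈ filteredSeries := fun i => by
  rw [invAddFour, coeff_mk]
  exact C_mem_degLE _ _ _

theorem coeff_zero_invProductSeries : coeff 0 invProductSeries = 1 := by
  simp [invProductSeries, completeHomogeneous]

theorem coeff_zero_invAddFour : coeff 0 invAddFour = MvPolynomial.C (1 / 4) := by
  simp [invAddFour]

/-- Coefficientwise evaluation of a power series at the `q`-zeta values. -/
def evalSeries (q : ℂ) : ZetaPoly⟦X⟧ →+* ℂ⟦X⟧ := map (zetaEval q).toRingHom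

theorem coeff_evalSeries (q : ℂ) (φ : ZetaPoly⟦X⟧) (i : ℕ) :
    coeff i (evalSeries q φ) = zetaEval q (coeff i φ) := coeff_map _ _ _

theorem zetaEval_C (q : ℂ) (c : ℚ) : zetaEval q (MvPolynomial.C c) = c := by
  rw [← MvPolynomial.algebraMap_eq, AlgHom.commutes, eq_ratCast]

theorem evalSeries_X (q : ℂ) : evalSeries q X = X := map_X _

theorem evalSeries_C (q : ℂ) (c : ℚ) : evalSeries q (C (MvPolynomial.C c)) = C (c : ℂ) := by
  rw [evalSeries, map_C]
  exact congrArg _ (zetaEval_C q c)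

theorem taylorSeries_invProduct (hq : ‖q‖ < 1) :
    AnalyticAt ℂ (fun r => invProduct q (r * (r + 4))) 0 ∧
    (taylorSeries fun r => invProduct q (r * (r + 4))) = evalSeries q invProductSeries := by
  obtain ⟨h1, h2⟩ := analyticAt_invProduct hq
  refine ⟨AnalyticAt.fun_comp (by simpa using h1) (by fun_prop), ?_⟩
  ext i
  rw [coeff_taylorSeries_comp h1, coeff_evalSeries, invProductSeries, coeff_mk, map_sum]
  refine Finset.sum_congr rfl fun m _ => ?_
  rw [map_mul, h2, ← coeff_evalSeries, map_pow (evalSeries q), map_mul (evalSeries q),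
    map_add (evalSeries q), evalSeries_X, evalSeries_C, Rat.cast_ofNat]

theorem taylorSeries_inv_add_four (q : ℂ) :
    taylorSeries (fun r => (r + 4)⁻¹) = evalSeries q invAddFour := by
  have h : AnalyticAt ℂ (fun r : ℂ => r + 4) 0 := by fun_prop
  refine taylorSeries_eq_of_mul_eq_one h (h.fun_inv (by norm_num)) ?_
    (by rw [taylorSeries_add (by fun_prop) (by fun_prop), taylorSeries_id, taylorSeries_const]) ?_
  · have : ∀ᶠ r : ℂ in 𝓝 0, r + 4 ≠ 0 := h.continuousAt.eventually_ne (by norm_num)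
    filter_upwards [this] with r hr using mul_inv_cancel₀ hr
  · ext i
    rw [add_mul, map_add, coeff_C_mul]
    rcases i with _ | i
    · simp [coeff_evalSeries, invAddFour]
    · rw [coeff_succ_X_mul, coeff_one, if_neg i.succ_ne_zero, coeff_evalSeries, coeff_evalSeries,
        invAddFour, coeff_mk, coeff_mk, zetaEval_C, zetaEval_C]
      push_cast
      field_simp
      ring

end ZetaValues

section Kernel

variable {q : ℂ} {a : ℂ}

/-! ### Okuyama's kernel near a branch point -/

theorem okuyamaY_eq (hq : ‖q‖ < 1) {p : ℂ} (hp : p ≠ 0) :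
    okuyamaY q p = (1 / 2) * (p - p⁻¹) * (invProduct q ((p - p⁻¹) ^ 2))⁻¹ := by
  rw [okuyamaY, invProduct, inv_inv]
  congr 1
  refine tprod_congr fun k => ?_
  have h := one_sub_pow_ne_zero hq k
  rw [node]
  generalize q ^ (k + 1) = Q at *
  field_simp
  ring

theorem okuyamaY_inv (hq : ‖q‖ < 1) {p : ℂ} (hp : p ≠ 0) :
    okuyamaY q p⁻¹ = -okuyamaY q p := by
  rw [okuyamaY_eq hq hp, okuyamaY_eq hq (inv_ne_zero hp), inv_inv,
    show (p⁻¹ - p) ^ 2 = (p - p⁻¹) ^ 2 by ring]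
  ring

theorem deriv_sigma (p : ℂ) : deriv sigma p = -(p ^ 2)⁻¹ := by
  rw [show sigma = fun p : ℂ => p⁻¹ from rfl, deriv_inv]

/-- The denominator `(1 - a z)² - a z r = z² - z x + 1` of the recursion kernel, `x = a (r + 2)`. -/
def kernelDenom (a z r : ℂ) : ℂ := (1 - a * z) ^ 2 - a * z * r

theorem kernelDenom_branchCoord (ha : a ^ 2 = 1) (z : ℂ) {p : ℂ} (hp : p ≠ 0) :
    kernelDenom a z (branchCoord a p) = (z - p⁻¹) * (z - p) := by
  rw [kernelDenom, branchCoord, xFun]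
  field_simp
  linear_combination (-z * (1 + p ^ 2) + p * z ^ 2) * ha

theorem one_sub_mul_ne_zero (ha : a ^ 2 = 1) {z : ℂ} (hz : z ^ 2 ≠ 1) : 1 - a * z ≠ 0 := by
  intro h
  apply hz
  linear_combination (-(a * z) - 1) * h - z ^ 2 * ha

theorem kernelDenom_zero_ne_zero (ha : a ^ 2 = 1) {z : ℂ} (hz : z ^ 2 ≠ 1) :
    kernelDenom a z 0 ≠ 0 := by
  rw [kernelDenom, mul_zero, sub_zero]
  exact pow_ne_zero _ (one_sub_mul_ne_zero ha hz)

theorem analyticAt_kernelDenom (a z : ℂ) : AnalyticAt ℂ (kernelDenom a z) 0 := by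
  unfold kernelDenom
  fun_prop

theorem eventually_kernelDenom_ne_zero (ha : a ^ 2 = 1) {z : ℂ} (hz : z ^ 2 ≠ 1) :
    ∀ᶠ r in 𝓝 0, kernelDenom a z r ≠ 0 :=
  (analyticAt_kernelDenom a z).continuousAt.eventually_ne (kernelDenom_zero_ne_zero ha hz)

theorem eventually_kernelDenom_branchCoord_ne_zero (ha : a ^ 2 = 1) {z : ℂ} (hz : z ^ 2 ≠ 1) :
    ∀ᶠ p in 𝓝[≠] a, kernelDenom a z (branchCoord a p) ≠ 0 :=
  ((tendsto_branchCoord ha).eventually (eventually_kernelDenom_ne_zero ha hz)).filter_mono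
    nhdsWithin_le_nhds

theorem kernel_okuyamaY (hq : ‖q‖ < 1) (ha : a ^ 2 = 1) {z p : ℂ} (hp : p ≠ 0) (hp1 : p ^ 2 ≠ 1)
    (hzp : kernelDenom a z (branchCoord a p) ≠ 0) :
    kernel (okuyamaY q) z p * p⁻¹ ^ 2 = -(1 / 2) * (a * (kernelDenom a z (branchCoord a p))⁻¹) *
      (invProduct q (branchCoord a p * (branchCoord a p + 4)) * (branchCoord a p + 4)⁻¹) *
      (branchCoord a p)⁻¹ * (a * (1 - (p ^ 2)⁻¹)) := by
  have hr := branchCoord_ne_zero ha hp hp1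
  have hr4 := branchCoord_add_four_ne_zero ha hp hp1
  have hprod : (branchCoord a p + 4)⁻¹ * (branchCoord a p)⁻¹ = ((p - p⁻¹) ^ 2)⁻¹ := by
    rw [← mul_inv, mul_comm (branchCoord a p + 4), branchCoord_mul ha hp]
  rw [kernelDenom_branchCoord ha z hp] at hzp
  have h1 : z - p⁻¹ ≠ 0 := left_ne_zero_of_mul hzp
  have h2 : z - p ≠ 0 := right_ne_zero_of_mul hzp
  have h3 : p - p⁻¹ ≠ 0 := fun h => hp1 (by field_simp at h; linear_combination h)
  have hnum : 1 / (z - sigma p) - 1 / (z - p) = -(p - p⁻¹) * ((z - p⁻¹) * (z - p))⁻¹ := by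
    rw [sigma]
    rw [mul_inv]
    have e1 : (z - p⁻¹) * (z - p⁻¹)⁻¹ = 1 := mul_inv_cancel₀ h1
    have e2 : (z - p) * (z - p)⁻¹ = 1 := mul_inv_cancel₀ h2
    rw [one_div, one_div]
    linear_combination (z - p)⁻¹ * e1 - (z - p⁻¹)⁻¹ * e2
  have hden : omega01 (okuyamaY q) p - omega01 (okuyamaY q) (sigma p) * deriv sigma p =
      (p - p⁻¹) ^ 2 * p⁻¹ * (invProduct q ((p - p⁻¹) ^ 2))⁻¹ := by
    rw [omega01, omega01, deriv_sigma, sigma, okuyamaY_inv hq hp, (hasDerivAt_xFun hp).deriv,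
      (hasDerivAt_xFun (inv_ne_zero hp)).deriv, okuyamaY_eq hq hp]
    generalize (invProduct q ((p - p⁻¹) ^ 2))⁻¹ = E
    field_simp
    ring
  rw [kernel, hnum, hden, kernelDenom_branchCoord ha z hp, branchCoord_mul ha hp]
  generalize ((z - p⁻¹) * (z - p))⁻¹ = Z
  rw [mul_assoc (-(1 / 2) * (a * Z)), mul_assoc _ _ (branchCoord a p)⁻¹, hprod, div_eq_mul_inv,
    mul_inv, mul_inv, inv_inv, inv_inv]
  generalize invProduct q ((p - p⁻¹) ^ 2) = E
  have h4 : (p - p⁻¹) ^ 2 * ((p - p⁻¹) ^ 2)⁻¹ = 1 := mul_inv_cancel₀ (pow_ne_zero _ h3)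
  generalize ((p - p⁻¹) ^ 2)⁻¹ = S
  field_simp
  linear_combination (E * Z * S) * ha

/-- The basis of differentials: `xi a k z dz` has its only pole at `1/a = a = ±1`, is odd under
`z ↦ 1/z`, and equals `r^{-k-1} dz/z` in the coordinate `r = branchCoord a z`. -/
def xi (a : ℂ) (k : ℕ) (z : ℂ) : ℂ := a * (a * z) ^ k / (1 - a * z) ^ (2 * k + 2)

/-- The part of the recursion kernel that depends on its first argument generates the basis. -/
theorem taylorSeries_kernelDenom (ha : a ^ 2 = 1) {z : ℂ} (hz : z ^ 2 ≠ 1) :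
    AnalyticAt ℂ (fun r => a * (kernelDenom a z r)⁻¹) 0 ∧
    taylorSeries (fun r => a * (kernelDenom a z r)⁻¹) = .mk fun k => xi a k z := by
  have h0 := one_sub_mul_ne_zero ha hz
  have hA := analyticAt_kernelDenom a z
  have hB : AnalyticAt ℂ (fun r => a * (kernelDenom a z r)⁻¹) 0 :=
    analyticAt_const.fun_mul (hA.fun_inv (kernelDenom_zero_ne_zero ha hz))
  refine ⟨hB, taylorSeries_eq_of_mul_eq_one (f := fun r => a * (1 - a * z) ^ 2 + -z * r)
    (φ := C (a * (1 - a * z) ^ 2) + C (-z) * X) (by fun_prop) hB ?_ ?_ ?_⟩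
  · filter_upwards [eventually_kernelDenom_ne_zero ha hz] with r hr
    have : a * (1 - a * z) ^ 2 + -z * r = a * kernelDenom a z r := by
      rw [kernelDenom]; linear_combination z * r * ha
    rw [this, mul_mul_mul_comm, mul_inv_cancel₀ hr, ← sq, ha, one_mul]
  · rw [taylorSeries_add (by fun_prop) (by fun_prop), taylorSeries_const,
      taylorSeries_mul (by fun_prop) (by fun_prop), taylorSeries_const, taylorSeries_id]
  · ext k
    rw [add_mul, map_add, coeff_C_mul, mul_assoc (C (-z)), coeff_C_mul, coeff_mk]
    rcases k with _ | k
    · rw [coeff_zero_X_mul, coeff_zero_one, xi]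
      generalize 1 - a * z = w at h0 ⊢
      field_simp
      linear_combination w ^ 2 * ha
    · rw [coeff_succ_X_mul, coeff_mk, coeff_one, if_neg k.succ_ne_zero, xi, xi]
      generalize 1 - a * z = w at h0 ⊢
      have : a * w ^ 2 * (a * (a * z) ^ (k + 1) / w ^ (2 * (k + 1) + 2)) +
          -z * (a * (a * z) ^ k / w ^ (2 * k + 2)) =
          (a ^ 2 - 1) * (a * z * (a * z) ^ k / w ^ (2 * k + 2)) := by
        rw [show 2 * (k + 1) + 2 = 2 * k + 2 + 2 by ring, pow_add w (2 * k + 2)]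
        generalize w ^ (2 * k + 2) = v
        have hw : w ^ 2 * (w ^ 2)⁻¹ = 1 := mul_inv_cancel₀ (pow_ne_zero 2 h0)
        rw [div_eq_mul_inv, mul_inv, div_eq_mul_inv, div_eq_mul_inv]
        linear_combination (a ^ 2 * (a * z) ^ (k + 1) * v⁻¹) * hw
      rw [this, ha, sub_self, zero_mul]

/-- The power series in `r` of `1 / ((r + 4) ∏ (1 - s uₖ))`. -/
def kernelSeries : ZetaPoly⟦X⟧ := invProductSeries * invAddFour

/-- The residue at a branch point that defines the recursion, for a quadratic differential
`W = -r^{-M} ψ(r) (dp/p)²`. -/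
theorem hasResidue_kernel_mul (hq : ‖q‖ < 1) (ha : a ^ 2 = 1) {z : ℂ} (hz : z ^ 2 ≠ 1) {W ψ : ℂ → ℂ}
    (hψ : AnalyticAt ℂ ψ 0) (M : ℕ)
    (hW : ∀ᶠ p in 𝓝[≠] a, W p * p ^ 2 = -(ψ (branchCoord a p) * (branchCoord a p ^ M)⁻¹)) :
    HasResidue (fun p => kernel (okuyamaY q) z p * W p) a
      (coeff M (.mk (fun k => xi a k z) * (taylorSeries ψ * evalSeries q kernelSeries))) := by
  obtain ⟨hK, hKT⟩ := taylorSeries_kernelDenom ha hz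
  obtain ⟨hE, hET⟩ := taylorSeries_invProduct hq
  have h4 : AnalyticAt ℂ (fun r : ℂ => (r + 4)⁻¹) 0 :=
    (analyticAt_id.fun_add analyticAt_const).fun_inv (by norm_num)
  have hT : taylorSeries (fun r => a * (kernelDenom a z r)⁻¹ * (ψ r *
      (invProduct q (r * (r + 4)) * (r + 4)⁻¹))) =
      .mk (fun k => xi a k z) * (taylorSeries ψ * evalSeries q kernelSeries) := by
    rw [taylorSeries_mul hK (hψ.fun_mul (hE.fun_mul h4)), taylorSeries_mul hψ (hE.fun_mul h4),
      taylorSeries_mul hE h4, hKT, hET, taylorSeries_inv_add_four q, ← map_mul, kernelSeries]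
  have h := (hasResidue_comp_branchCoord ha M
    (hK.fun_mul (hψ.fun_mul (hE.fun_mul h4)))).const_mul (1 / 2)
  rw [hT, ← mul_assoc, one_div, inv_mul_cancel₀ two_ne_zero, one_mul] at h
  refine h.congr ?_
  filter_upwards [eventually_ne_branch ha, hW, eventually_kernelDenom_branchCoord_ne_zero ha hz]
    with p ⟨hp, hp1⟩ hWp hzp
  have hr := branchCoord_ne_zero ha hp hp1
  have e : kernel (okuyamaY q) z p * W p =
      kernel (okuyamaY q) z p * p⁻¹ ^ 2 * (W p * p ^ 2) := by field_simp
  rw [e, hWp, kernel_okuyamaY hq ha hp hp1 hzp, pow_succ, mul_inv]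
  ring

/-! ### The basis near the branch points -/

theorem branchCoord_inv (a p : ℂ) : branchCoord a p⁻¹ = branchCoord a p := by
  rw [branchCoord, branchCoord, xFun, xFun, inv_inv, add_comm]

/-- `xi b k` near the branch point `a`, up to the factor `r^{-k-1} dz/z`. -/
def localFactor (a b : ℂ) (k : ℕ) (r : ℂ) : ℂ :=
  if b = a then 1 else (-(r * (r + 4)⁻¹)) ^ (k + 1)

theorem xi_mul_self {b : ℂ} (ha : a ^ 2 = 1) (hb : b ^ 2 = 1) (k : ℕ) {p : ℂ} (hp : p ≠ 0)
    (hp1 : p ^ 2 ≠ 1) :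
    xi b k p * p = (branchCoord a p ^ (k + 1))⁻¹ * localFactor a b k (branchCoord a p) := by
  have h0 := ne_zero_of_sq_eq_one ha
  have hpa : 1 - b * p ≠ 0 := one_sub_mul_ne_zero hb hp1
  have hx : xi b k p * p = (b * p / (1 - b * p) ^ 2) ^ (k + 1) := by
    rw [xi, div_pow, ← pow_mul, pow_succ (b * p), mul_add, mul_one]
    ring
  have hr := branchCoord_ne_zero ha hp hp1
  have hr4 := branchCoord_add_four_ne_zero ha hp hp1
  rw [hx, localFactor]
  split_ifs with h
  · subst h
    rw [mul_one, ← inv_pow]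
    congr 1
    rw [branchCoord_eq ha hp] at hr ⊢
    have : b * (p - b) ^ 2 / p = (1 - b * p) ^ 2 / (b * p) := by
      field_simp
      linear_combination (b ^ 2 + 1 - 2 * b * p) * ha
    rw [this, inv_div]
  · have hba : b = -a := (sq_eq_sq_iff_eq_or_eq_neg.1 (hb.trans ha.symm)).resolve_left h
    rw [← inv_pow, ← mul_pow]
    congr 1
    rw [mul_neg, ← mul_assoc, inv_mul_cancel₀ hr, one_mul]
    subst hba
    rw [branchCoord_add_four ha hp]
    have : a * (p + a) ^ 2 / p = (1 + a * p) ^ 2 / (a * p) := by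
      field_simp
      linear_combination (a ^ 2 + 1 + 2 * a * p) * ha
    rw [this, inv_div, neg_mul, sub_neg_eq_add, neg_div]

end Kernel

section LocalResidues

variable {q : ℂ}

/-! ### Local series at the branch points -/

/-- The branch point `1` or `-1` with a given sign. -/
def branch (a : ℤˣ) : ℂ := ((a : ℤ) : ℂ)

theorem branch_sq (a : ℤˣ) : branch a ^ 2 = 1 := by
  rcases Int.units_eq_one_or a with rfl | rfl <;> simp [branch]

theorem branch_injective : Function.Injective branch := fun a b h => by
  rw [branch, branch, Int.cast_inj] at h
  exact Units.ext h

/-- The Taylor series in `r` of `localFactor`. -/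
def localSeries (a b : ℤˣ) (k : ℕ) : ZetaPoly⟦X⟧ :=
  if b = a then 1 else (-(X * invAddFour)) ^ (k + 1)

theorem taylorSeries_localFactor (q : ℂ) (a b : ℤˣ) (k : ℕ) :
    AnalyticAt ℂ (localFactor (branch a) (branch b) k) 0 ∧
    taylorSeries (localFactor (branch a) (branch b) k) = evalSeries q (localSeries a b k) := by
  unfold localFactor localSeries
  simp only [branch_injective.eq_iff]
  by_cases h : b = a
  · simp only [if_pos h]
    exact ⟨analyticAt_const, by rw [taylorSeries_const, map_one, map_one]⟩
  · simp only [if_neg h]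
    have h4 : AnalyticAt ℂ (fun r : ℂ => (r + 4)⁻¹) 0 :=
      (analyticAt_id.fun_add analyticAt_const).fun_inv (by norm_num)
    have h5 : AnalyticAt ℂ (fun r : ℂ => r * (r + 4)⁻¹) 0 := analyticAt_id.fun_mul h4
    have h6 : AnalyticAt ℂ (fun r : ℂ => -1 * (r * (r + 4)⁻¹)) 0 := analyticAt_const.fun_mul h5
    simp only [← neg_one_mul (_ * _ : ℂ)]
    refine ⟨h6.fun_pow _, ?_⟩
    rw [taylorSeries_pow h6, taylorSeries_mul analyticAt_const h5, taylorSeries_const,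
      taylorSeries_mul (by fun_prop) h4, taylorSeries_id, taylorSeries_inv_add_four q, map_pow,
      map_neg (evalSeries q), map_mul, evalSeries_X, map_neg, map_one, neg_one_mul]

theorem kernelSeries_mem : kernelSeries ∈ filteredSeries :=
  mul_mem invProductSeries_mem invAddFour_mem

theorem localSeries_mem (a b : ℤˣ) (k : ℕ) : localSeries a b k ∈ filteredSeries := by
  rw [localSeries]
  split_ifs
  · exact one_mem _
  · exact pow_mem (neg_mem (mul_mem X_mem_filteredSeries invAddFour_mem)) _

theorem coeff_zero_mul_eq {R : Type*} [Semiring R] (φ ψ : R⟦X⟧) :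
    coeff 0 (φ * ψ) = coeff 0 φ * coeff 0 ψ := by simp [coeff_mul]

/-! ### Residues of the terms of the recursion -/

theorem eventually_inv_ne {a : ℂ} (ha : a ^ 2 = 1) :
    ∀ᶠ p : ℂ in 𝓝[≠] a, p⁻¹ ≠ 0 ∧ p⁻¹ ^ 2 ≠ 1 := by
  filter_upwards [eventually_ne_branch ha] with p ⟨hp, hp1⟩
  exact ⟨inv_ne_zero hp, by rwa [inv_pow, Ne, inv_eq_one]⟩

theorem hasResidue_kernel_xi_mul_xi (hq : ‖q‖ < 1) (a b c : ℤˣ) (k l : ℕ) {z : ℂ}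
    (hz : z ^ 2 ≠ 1) :
    HasResidue (fun p => kernel (okuyamaY q) z p *
        (xi (branch b) k p * (xi (branch c) l (sigma p) * deriv sigma p))) (branch a)
      (coeff (k + l + 2) (.mk (fun j => xi (branch a) j z) *
        evalSeries q (localSeries a b k * localSeries a c l * kernelSeries))) := by
  obtain ⟨h1, h1T⟩ := taylorSeries_localFactor q a b k
  obtain ⟨h2, h2T⟩ := taylorSeries_localFactor q a c l
  have h := hasResidue_kernel_mul hq (branch_sq a) hz (h1.fun_mul h2) (k + l + 2)
    (W := fun p => xi (branch b) k p * (xi (branch c) l (sigma p) * deriv sigma p)) (by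
      filter_upwards [eventually_ne_branch (branch_sq a), eventually_inv_ne (branch_sq a)]
        with p ⟨hp, hp1⟩ ⟨hp', hp1'⟩
      have e1 := xi_mul_self (branch_sq a) (branch_sq b) k hp hp1
      have e2 := xi_mul_self (branch_sq a) (branch_sq c) l hp' hp1'
      rw [branchCoord_inv] at e2
      have e3 : p * p⁻¹ = 1 := mul_inv_cancel₀ hp
      rw [deriv_sigma, sigma, ← inv_pow]
      calc _ = -((xi (branch b) k p * p) * (xi (branch c) l p⁻¹ * p⁻¹)) * (p * p⁻¹) := by ring
        _ = _ := by rw [e1, e2, e3, show k + l + 2 = k + 1 + (l + 1) by ring, pow_add, mul_inv]; ring)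
  rw [taylorSeries_mul h1 h2, h1T, h2T] at h
  rwa [map_mul (evalSeries q), map_mul (evalSeries q)]

/-- The Taylor series in `r` of `p / (p - z)² + p / (1 - p z)²`. -/
theorem taylorSeries_bidifferential {a z : ℂ} (ha : a ^ 2 = 1) (hz : z ^ 2 ≠ 1) :
    AnalyticAt ℂ (fun r => (r + 2) * (a * (kernelDenom a z r)⁻¹) +
      r * (r + 4) * deriv (fun r => a * (kernelDenom a z r)⁻¹) r) 0 ∧
    taylorSeries (fun r => (r + 2) * (a * (kernelDenom a z r)⁻¹) +
      r * (r + 4) * deriv (fun r => a * (kernelDenom a z r)⁻¹) r) =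
      (X + C 2) * .mk (fun k => xi a k z) +
        X * (X + C 4) * derivative ℂ (.mk fun k => xi a k z) := by
  obtain ⟨hK, hKT⟩ := taylorSeries_kernelDenom ha hz
  have h2 : AnalyticAt ℂ (fun r : ℂ => r + 2) 0 := by fun_prop
  have h4 : AnalyticAt ℂ (fun r : ℂ => r * (r + 4)) 0 := by fun_prop
  refine ⟨(h2.fun_mul hK).fun_add (h4.fun_mul hK.deriv), ?_⟩
  rw [taylorSeries_add (h2.fun_mul hK) (h4.fun_mul hK.deriv), taylorSeries_mul h2 hK,
    taylorSeries_mul h4 hK.deriv, taylorSeries_deriv, hKT,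
    taylorSeries_mul (by fun_prop) (by fun_prop), taylorSeries_add (by fun_prop) (by fun_prop),
    taylorSeries_add (by fun_prop) (by fun_prop), taylorSeries_id, taylorSeries_const,
    taylorSeries_const]

theorem deriv_kernelDenom {a z r : ℂ} (ha : a ^ 2 = 1) (hr : kernelDenom a z r ≠ 0) :
    deriv (fun r => a * (kernelDenom a z r)⁻¹) r = z * ((kernelDenom a z r)⁻¹) ^ 2 := by
  have h : HasDerivAt (kernelDenom a z) (-(a * z)) r := by
    have := ((hasDerivAt_id r).const_mul (a * z)).const_sub ((1 - a * z) ^ 2)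
    rwa [mul_one] at this
  rw [((h.fun_inv hr).const_mul a).deriv]
  rw [neg_neg, div_eq_mul_inv, inv_pow]
  linear_combination (z * (kernelDenom a z r ^ 2)⁻¹) * ha

theorem bidifferential_eq {a z p : ℂ} (ha : a ^ 2 = 1) (hp : p ≠ 0)
    (hzp : kernelDenom a z (branchCoord a p) ≠ 0) :
    p * ((p - z)⁻¹) ^ 2 + p⁻¹ * ((p⁻¹ - z)⁻¹) ^ 2 =
      (branchCoord a p + 2) * (a * (kernelDenom a z (branchCoord a p))⁻¹) +
      branchCoord a p * (branchCoord a p + 4) *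
        deriv (fun r => a * (kernelDenom a z r)⁻¹) (branchCoord a p) := by
  rw [deriv_kernelDenom ha hzp, branchCoord_mul ha hp]
  rw [kernelDenom_branchCoord ha z hp] at hzp ⊢
  have h1 : p⁻¹ - z ≠ 0 := by rw [← neg_sub]; exact neg_ne_zero.2 (left_ne_zero_of_mul hzp)
  have h2 : p - z ≠ 0 := by rw [← neg_sub]; exact neg_ne_zero.2 (right_ne_zero_of_mul hzp)
  rw [show (z - p⁻¹) * (z - p) = (p⁻¹ - z) * (p - z) by ring, mul_inv]
  have e : (branchCoord a p + 2) * (a * ((p⁻¹ - z)⁻¹ * (p - z)⁻¹)) =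
      (p + p⁻¹) * ((p⁻¹ - z)⁻¹ * (p - z)⁻¹) := by
    rw [branchCoord, xFun]
    linear_combination ((p + p⁻¹) * ((p⁻¹ - z)⁻¹ * (p - z)⁻¹)) * ha
  rw [e]
  have f1 : (p⁻¹ - z) * (p⁻¹ - z)⁻¹ = 1 := mul_inv_cancel₀ h1
  have f2 : (p - z) * (p - z)⁻¹ = 1 := mul_inv_cancel₀ h2
  have f3 : p * p⁻¹ = 1 := mul_inv_cancel₀ hp
  generalize hu : (p⁻¹ - z)⁻¹ = u at *
  generalize hv : (p - z)⁻¹ = v at *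
  generalize hw : p⁻¹ = w at *
  have : p * v ^ 2 * ((w - z) * u) ^ 2 + w * u ^ 2 * ((p - z) * v) ^ 2 =
      (p + w) * (u * v) * (((w - z) * u) * ((p - z) * v)) + (p - w) ^ 2 * (z * (u * v) ^ 2) := by
    ring
  rw [f1, f2] at this
  linear_combination this

theorem hasResidue_kernel_bidifferential_mul_xi (hq : ‖q‖ < 1) (a b : ℤˣ) (k : ℕ) {z z' : ℂ}
    (hz : z ^ 2 ≠ 1) (hz' : z' ^ 2 ≠ 1) :
    HasResidue (fun p => kernel (okuyamaY q) z p *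
        (1 / (p - z') ^ 2 * (xi (branch b) k (sigma p) * deriv sigma p) +
          xi (branch b) k p * (1 / (sigma p - z') ^ 2 * deriv sigma p))) (branch a)
      (coeff (k + 1) (.mk (fun j => xi (branch a) j z) *
        (((X + C 2) * .mk (fun k => xi (branch a) k z') +
          X * (X + C 4) * derivative ℂ (.mk fun k => xi (branch a) k z')) *
        evalSeries q (localSeries a b k * kernelSeries)))) := by
  obtain ⟨h1, h1T⟩ := taylorSeries_localFactor q a b k
  obtain ⟨h2, h2T⟩ := taylorSeries_bidifferential (branch_sq a) hz'
  have h := hasResidue_kernel_mul hq (branch_sq a) hz (h2.fun_mul h1) (k + 1)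
    (W := fun p => 1 / (p - z') ^ 2 * (xi (branch b) k (sigma p) * deriv sigma p) +
          xi (branch b) k p * (1 / (sigma p - z') ^ 2 * deriv sigma p)) (by
      filter_upwards [eventually_ne_branch (branch_sq a), eventually_inv_ne (branch_sq a),
        eventually_kernelDenom_branchCoord_ne_zero (branch_sq a) hz']
        with p ⟨hp, hp1⟩ ⟨hp', hp1'⟩ hzp
      have e1 := xi_mul_self (branch_sq a) (branch_sq b) k hp hp1
      have e2 := xi_mul_self (branch_sq a) (branch_sq b) k hp' hp1'
      rw [branchCoord_inv] at e2
      have e3 : p * p⁻¹ = 1 := mul_inv_cancel₀ hp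
      rw [← bidifferential_eq (branch_sq a) hp hzp, deriv_sigma, sigma, ← inv_pow, one_div,
        one_div, ← inv_pow, ← inv_pow]
      have e4 : xi (branch b) k p⁻¹ = xi (branch b) k p⁻¹ * p⁻¹ * p := by field_simp
      have e5 : xi (branch b) k p = xi (branch b) k p * p * p⁻¹ := by field_simp
      rw [e4, e5, e1, e2]
      generalize (branchCoord (branch a) p ^ (k + 1))⁻¹ = R
      generalize localFactor (branch a) (branch b) k (branchCoord (branch a) p) = L
      generalize (p - z')⁻¹ = u
      generalize (p⁻¹ - z')⁻¹ = v
      field_simp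
      ring)
  rw [taylorSeries_mul h2 h1, h1T, h2T] at h
  rwa [map_mul (evalSeries q), ← mul_assoc (_ + _)]

theorem hasResidue_kernel_bidifferential_mul_bidifferential (hq : ‖q‖ < 1) (a : ℤˣ) {z u v : ℂ}
    (hz : z ^ 2 ≠ 1) (hu : u ^ 2 ≠ 1) (hv : v ^ 2 ≠ 1) :
    HasResidue (fun p => kernel (okuyamaY q) z p *
        (1 / (p - u) ^ 2 * (1 / (sigma p - v) ^ 2 * deriv sigma p) +
          1 / (p - v) ^ 2 * (1 / (sigma p - u) ^ 2 * deriv sigma p))) (branch a)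
      (1 / 2 * xi (branch a) 0 z * (xi (branch a) 0 u * xi (branch a) 0 v)) := by
  have ha := branch_sq a
  set α := branch a
  have hK := ((analyticAt_kernelDenom α u).fun_inv (kernelDenom_zero_ne_zero ha hu)).fun_mul
    ((analyticAt_kernelDenom α v).fun_inv (kernelDenom_zero_ne_zero ha hv))
  -- Times `p²`, the two terms are `-A² / (A B)²` and `-B² / (A B)²` for `A = (1/p - u) (p - v)`
  -- and `B = (p - u) (1/p - v)`. Here `A B` is a product of kernel denominators and `A + B` depends on
  -- `r` only, so that `ψ` is `(A² + B²) / (A B)² = ((A + B)² - 2 A B) / (A B)²`.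
  set ψ : ℂ → ℂ := fun r => ((kernelDenom α u r)⁻¹ * (kernelDenom α v r)⁻¹) ^ 2 *
    (2 * (1 + u * v) - α * (u + v) * (r + 2)) ^ 2 -
      2 * ((kernelDenom α u r)⁻¹ * (kernelDenom α v r)⁻¹) with hψdef
  have hψ : AnalyticAt ℂ ψ 0 :=
    ((hK.fun_pow 2).fun_mul (by fun_prop)).fun_sub (analyticAt_const.fun_mul hK)
  have h := hasResidue_kernel_mul hq ha hz hψ 0
    (W := fun p => 1 / (p - u) ^ 2 * (1 / (sigma p - v) ^ 2 * deriv sigma p) +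
          1 / (p - v) ^ 2 * (1 / (sigma p - u) ^ 2 * deriv sigma p)) (by
      filter_upwards [eventually_ne_branch ha,
        eventually_kernelDenom_branchCoord_ne_zero ha hu,
        eventually_kernelDenom_branchCoord_ne_zero ha hv] with p ⟨hp, hp1⟩ hup hvp
      rw [hψdef]
      simp only
      rw [kernelDenom_branchCoord ha _ hp] at hup hvp ⊢
      rw [kernelDenom_branchCoord ha _ hp, deriv_sigma, sigma, branchCoord, xFun]
      have h1 : p⁻¹ - u ≠ 0 := by rw [← neg_sub]; exact neg_ne_zero.2 (left_ne_zero_of_mul hup)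
      have h2 : p - u ≠ 0 := by rw [← neg_sub]; exact neg_ne_zero.2 (right_ne_zero_of_mul hup)
      have h3 : p⁻¹ - v ≠ 0 := by rw [← neg_sub]; exact neg_ne_zero.2 (left_ne_zero_of_mul hvp)
      have h4 : p - v ≠ 0 := by rw [← neg_sub]; exact neg_ne_zero.2 (right_ne_zero_of_mul hvp)
      rw [show (u - p⁻¹) * (u - p) = (p⁻¹ - u) * (p - u) by ring,
        show (v - p⁻¹) * (v - p) = (p⁻¹ - v) * (p - v) by ring,
        show 2 * (1 + u * v) - α * (u + v) * (α * (p + p⁻¹) - 2 + 2) =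
          2 * (1 + u * v) - (u + v) * (p + p⁻¹) by
            linear_combination (-(u + v) * (p + p⁻¹)) * ha]
      have e3 : p * p⁻¹ = 1 := mul_inv_cancel₀ hp
      have e4 : p ^ 2 * (p ^ 2)⁻¹ = 1 := mul_inv_cancel₀ (pow_ne_zero 2 hp)
      have hA : (p⁻¹ - u) * (p - v) * ((p⁻¹ - u)⁻¹ * (p - v)⁻¹) = 1 := by
        rw [mul_mul_mul_comm, mul_inv_cancel₀ h1, mul_inv_cancel₀ h4, one_mul]
      have hB : (p - u) * (p⁻¹ - v) * ((p - u)⁻¹ * (p⁻¹ - v)⁻¹) = 1 := by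
        rw [mul_mul_mul_comm, mul_inv_cancel₀ h2, mul_inv_cancel₀ h3, one_mul]
      rw [show 2 * (1 + u * v) - (u + v) * (p + p⁻¹) =
        (p⁻¹ - u) * (p - v) + (p - u) * (p⁻¹ - v) by linear_combination (-2 : ℂ) * e3,
        one_div, one_div, one_div, one_div, mul_inv, mul_inv, ← inv_pow (p - u), ← inv_pow (p - v),
        ← inv_pow (p⁻¹ - u), ← inv_pow (p⁻¹ - v), pow_zero, inv_one, mul_one]
      generalize (p⁻¹ - u) * (p - v) = A at *
      generalize (p - u) * (p⁻¹ - v) = B at *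
      generalize (p⁻¹ - u)⁻¹ = U' at *
      generalize (p - u)⁻¹ = U at *
      generalize (p⁻¹ - v)⁻¹ = V' at *
      generalize (p - v)⁻¹ = V at *
      calc _ = -((U * V') ^ 2 * 1 ^ 2 + (U' * V) ^ 2 * 1 ^ 2) * (p ^ 2 * (p ^ 2)⁻¹) := by ring
        _ = -((U * V') ^ 2 * (A * (U' * V)) ^ 2 + (U' * V) ^ 2 * (B * (U * V')) ^ 2 +
            2 * (U' * U * (V' * V)) * ((A * (U' * V)) * (B * (U * V')) - 1)) := by
          rw [hA, hB, e4]; ring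
        _ = _ := by ring)
  convert h using 1
  rw [coeff_zero_mul_eq, coeff_zero_mul_eq, coeff_zero_taylorSeries, coeff_evalSeries, kernelSeries,
    coeff_zero_mul_eq, coeff_zero_invProductSeries, coeff_zero_invAddFour, one_mul, zetaEval_C,
    coeff_mk, hψdef]
  have h1 := one_sub_mul_ne_zero ha hu
  have h2 := one_sub_mul_ne_zero ha hv
  simp only [kernelDenom, mul_zero, sub_zero, xi, pow_zero, zero_add, mul_one]
  rw [show 2 * (1 + u * v) - α * (u + v) * 2 = 2 * ((1 - α * u) * (1 - α * v)) by
    linear_combination (-2 * u * v) * ha]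
  generalize 1 - α * u = x at *
  generalize 1 - α * v = y at *
  generalize α / (1 - α * z) ^ 2 = t
  have e : α / x ^ 2 * (α / y ^ 2) = (x ^ 2)⁻¹ * (y ^ 2)⁻¹ := by
    rw [div_mul_div_comm, ← sq, ha, one_div, mul_inv]
  rw [e]
  push_cast
  field_simp
  ring

theorem hasResidue_kernel_bidifferential_diag (hq : ‖q‖ < 1) (a : ℤˣ) {z : ℂ} (hz : z ^ 2 ≠ 1) :
    HasResidue (fun p => kernel (okuyamaY q) z p * (1 / (p - sigma p) ^ 2 * deriv sigma p))
      (branch a) (coeff 1 (.mk (fun j => xi (branch a) j z) *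
        evalSeries q (invAddFour * kernelSeries))) := by
  have ha := branch_sq a
  have h4 : AnalyticAt ℂ (fun r : ℂ => (r + 4)⁻¹) 0 :=
    (analyticAt_id.fun_add analyticAt_const).fun_inv (by norm_num)
  have h := hasResidue_kernel_mul hq ha hz h4 1
    (W := fun p => 1 / (p - sigma p) ^ 2 * deriv sigma p) (by
      filter_upwards [eventually_ne_branch ha] with p ⟨hp, hp1⟩
      rw [← mul_inv, mul_comm (_ + _), pow_one, branchCoord_mul ha hp, deriv_sigma, sigma]
      have e4 : p ^ 2 * (p ^ 2)⁻¹ = 1 := mul_inv_cancel₀ (pow_ne_zero 2 hp)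
      rw [one_div]
      linear_combination (-((p - p⁻¹) ^ 2)⁻¹) * e4)
  rwa [taylorSeries_inv_add_four q, ← map_mul] at h

/-! ### Extraction of coefficients -/

theorem exists_mk_eq_sum_add (f : ℕ → ℂ) (N : ℕ) : ∃ R : ℂ⟦X⟧,
    (.mk f : ℂ⟦X⟧) = ∑ j : Fin N, C (f j) * X ^ (j : ℕ) + X ^ N * R := by
  have : X ^ N ∣ (.mk f - ∑ j : Fin N, C (f j) * X ^ (j : ℕ) : ℂ⟦X⟧) := by
    rw [X_pow_dvd_iff]
    intro m hm
    rw [map_sub, map_sum, coeff_mk, Finset.sum_eq_single (⟨m, hm⟩ : Fin N)]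
    · rw [coeff_C_mul, coeff_X_pow_self, mul_one, sub_self]
    · intro j _ hj
      rw [coeff_C_mul, coeff_X_pow, if_neg fun h => hj (Fin.ext h.symm), mul_zero]
    · simp
  obtain ⟨R, hR⟩ := this
  exact ⟨R, by rw [← hR]; ring⟩

theorem coeff_mk_mul (f : ℕ → ℂ) (ψ : ℂ⟦X⟧) {M N : ℕ} (h : M < N) :
    coeff M (.mk f * ψ) = ∑ j : Fin N, f j * coeff M (X ^ (j : ℕ) * ψ) := by
  obtain ⟨R, hR⟩ := exists_mk_eq_sum_add f N
  rw [hR, add_mul, map_add, mul_assoc, coeff_X_pow_mul', if_neg (by omega), add_zero,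
    Finset.sum_mul, map_sum]
  exact Finset.sum_congr rfl fun j _ => by rw [mul_assoc, coeff_C_mul]

/-- The coefficients `(4l + 2) r^l + (l + 1) r^{l+1}` with which the basis occurs in the
bidifferential, divided by `r^l`. -/
def bidifferentialSeries (l : ℕ) : ZetaPoly⟦X⟧ :=
  C (MvPolynomial.C (4 * l + 2 : ℚ)) + C (MvPolynomial.C (l + 1 : ℚ)) * X

theorem bidifferentialSeries_mem (l : ℕ) : bidifferentialSeries l ∈ filteredSeries :=
  add_mem (C_mem_filteredSeries _) (mul_mem (C_mem_filteredSeries _) X_mem_filteredSeries)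

theorem coeff_bidifferential_mul (f : ℕ → ℂ) (ψ : ℂ⟦X⟧) {M N : ℕ} (h : M < N) :
    coeff M (((X + C 2) * .mk f + X * (X + C 4) * derivative ℂ (.mk f)) * ψ) =
      ∑ l : Fin N, f l *
        coeff M (X ^ (l : ℕ) * evalSeries q (bidifferentialSeries l) * ψ) := by
  obtain ⟨R, hR⟩ := exists_mk_eq_sum_add f N
  have hX : ∀ n : ℕ, X * derivative ℂ (X ^ n : ℂ⟦X⟧) = C (n : ℂ) * X ^ n := by
    intro n
    rcases n with _ | n
    · simp
    · rw [derivative_pow, derivative_X, map_natCast, Nat.add_sub_cancel, pow_succ]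
      ring
  have hD : ∀ (n : ℕ) (φ : ℂ⟦X⟧), (X + C 2) * (X ^ n * φ) +
      X * (X + C 4) * derivative ℂ (X ^ n * φ) =
      X ^ n * ((X + C 2) * φ + (X + C 4) * (C (n : ℂ) * φ + X * derivative ℂ φ)) := by
    intro n φ
    rw [Derivation.leibniz, smul_eq_mul, smul_eq_mul]
    linear_combination ((X + C 4) * φ) * hX n
  have hC : ∀ l : ℕ, (X + C 2) * (C (f l) * X ^ l) +
      X * (X + C 4) * derivative ℂ (C (f l) * X ^ l) =
      C (f l) * (X ^ l * evalSeries q (bidifferentialSeries l)) := by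
    intro l
    have h2 : (C (4 * l + 2 : ℂ) : ℂ⟦X⟧) = C 4 * C (l : ℂ) + C 2 := by rw [map_add, map_mul]
    have h1 : (C (l + 1 : ℂ) : ℂ⟦X⟧) = C (l : ℂ) + 1 := by rw [map_add, map_one]
    rw [mul_comm (C (f l)), hD, derivative_C, bidifferentialSeries, map_add, map_mul, evalSeries_X,
      evalSeries_C, evalSeries_C]
    push_cast
    rw [h1, h2]
    ring
  have hsum : ((X + C 2) * .mk f + X * (X + C 4) * derivative ℂ (.mk f)) * ψ =
      (∑ l : Fin N, C (f l) * (X ^ (l : ℕ) * evalSeries q (bidifferentialSeries l) * ψ)) +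
      X ^ N * (((X + C 2) * R + (X + C 4) * (C (N : ℂ) * R + X * derivative ℂ R)) * ψ) := by
    rw [← mul_assoc (X ^ N), ← hD N R, hR, map_add, map_sum, mul_add (X + C 2), mul_add _ (∑ _, _),
      add_add_add_comm, add_mul, Finset.mul_sum, Finset.mul_sum, ← Finset.sum_add_distrib,
      Finset.sum_mul]
    congr 1
    refine Finset.sum_congr rfl fun l _ => ?_
    rw [hC, mul_assoc]
  rw [hsum, map_add, coeff_X_pow_mul', if_neg (by omega), add_zero, map_sum]
  exact Finset.sum_congr rfl fun l _ => by rw [coeff_C_mul]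

end LocalResidues

/-! ### Coefficients of bounded weight and non-negative leading part -/

/-- A coefficient of a term of order `e` in a quasi-polynomial of degree `D`: its weight is at most
`D - e` (so it vanishes if `D < e`), and it is a non-negative number if `e = D`. -/
structure Admissible (D e : ℕ) (c : ZetaPoly) : Prop where
  weight_le : ∀ m ∈ c.support, Finsupp.weight zetaWeight m + e ≤ D
  nonneg : D ≤ e → 0 ≤ MvPolynomial.constantCoeff c

namespace Admissible

variable {D D' e e' : ℕ} {c c' : ZetaPoly}

theorem zero (D e : ℕ) : Admissible D e 0 := ⟨by simp, by simp⟩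

theorem add (h : Admissible D e c) (h' : Admissible D e c') : Admissible D e (c + c') := by
  classical
  refine ⟨fun m hm => ?_, fun he => ?_⟩
  · rcases Finset.mem_union.1 (MvPolynomial.support_add hm) with h1 | h1
    exacts [h.weight_le m h1, h'.weight_le m h1]
  · rw [map_add]
    exact add_nonneg (h.nonneg he) (h'.nonneg he)

theorem le_of_ne_zero (h : Admissible D e c) (hc : c ≠ 0) : e ≤ D := by
  obtain ⟨m, hm⟩ := MvPolynomial.ne_zero_iff.1 hc
  have := h.weight_le m (MvPolynomial.mem_support_iff.2 hm)
  omega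

theorem mul (h : Admissible D e c) (h' : Admissible D' e' c') :
    Admissible (D + D') (e + e') (c * c') := by
  classical
  refine ⟨fun m hm => ?_, fun he => ?_⟩
  · obtain ⟨a, ha, b, hb, rfl⟩ := Finset.mem_add.1 (MvPolynomial.support_mul c c' hm)
    have h1 := h.weight_le a ha
    have h2 := h'.weight_le b hb
    rw [map_add]
    omega
  · rw [map_mul]
    by_cases hc : c = 0
    · simp [hc]
    by_cases hc' : c' = 0
    · simp [hc']
    have h1 := h.le_of_ne_zero hc
    have h2 := h'.le_of_ne_zero hc'
    exact mul_nonneg (h.nonneg (by omega)) (h'.nonneg (by omega))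

theorem cancel (h : Admissible D e c) {D' e' : ℕ} (he : D + e' = D' + e) : Admissible D' e' c :=
  ⟨fun m hm => by have := h.weight_le m hm; omega, fun _ => h.nonneg (by omega)⟩

theorem C_mul {r : ℚ} (hr : 0 ≤ r) (h : Admissible D e c) :
    Admissible D e (MvPolynomial.C r * c) := by
  rw [← zero_add D, ← zero_add e]
  refine mul ⟨fun m hm => ?_, fun _ => by simpa using hr⟩ h
  simpa using C_mem_degLE zetaWeight 0 r m hm

/-- The coefficients of a filtered power series times a monomial: a higher power of `r`, which becomes
a higher order in the first variable, leaves less weight to the coefficient. -/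
theorem coeff_X_pow_mul {φ : ZetaPoly⟦X⟧} (hφ : φ ∈ filteredSeries)
    (h0 : 0 ≤ MvPolynomial.constantCoeff (coeff 0 φ)) (P N : ℕ) :
    Admissible P N (coeff P (X ^ N * φ)) := by
  rw [coeff_X_pow_mul']
  split_ifs with h
  · refine ⟨fun m hm => ?_, fun h' => ?_⟩
    · have := hφ _ m hm
      omega
    · rwa [show P - N = 0 by omega]
  · exact zero P N

end Admissible

theorem coeff_zero_kernelSeries : coeff 0 kernelSeries = MvPolynomial.C (1 / 4) := by
  rw [kernelSeries, coeff_zero_mul_eq, coeff_zero_invProductSeries, coeff_zero_invAddFour, one_mul]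

theorem coeff_zero_localSeries (a b : ℤˣ) (k : ℕ) :
    coeff 0 (localSeries a b k) = if b = a then 1 else 0 := by
  rw [localSeries]
  split_ifs <;> simp

theorem coeff_zero_bidifferentialSeries (l : ℕ) :
    coeff 0 (bidifferentialSeries l) = MvPolynomial.C (4 * l + 2 : ℚ) := by
  rw [bidifferentialSeries, map_add, coeff_zero_mul_eq]
  simp

/-! ### Contributions to the recursion -/

/-- Labels of the basis differentials `xi`, with the order of the pole bounded. -/
abbrev Label (N : ℕ) : Type := ℤˣ × Fin N

/-- Half the degree, in the `bᵢ`, of the coefficients of `∏ xi`. -/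
def order {N n : ℕ} (κ : Fin n → Label N) : ℕ := ∑ i, ((κ i).2 : ℕ)

/-- The basis differential with a given label. -/
def basisFun {N : ℕ} (x : Label N) (z : ℂ) : ℂ := xi (branch x.1) x.2 z

/-- The products of basis differentials. -/
def basisProd {N n : ℕ} (κ : Fin n → Label N) (z : Fin n → ℂ) : ℂ := ∏ i, basisFun (κ i) (z i)

/-- The labels of the products in which the pole has the smallest order, and is at `z = 1`. -/
def IsLowest {N n : ℕ} (κ : Fin n → Label N) : Prop := ∀ i, (κ i).1 = 1 ∧ ((κ i).2 : ℕ) = 0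

/-- The residues at both branch points of the recursion kernel times the quadratic differential
`W q z` are combinations of basis differentials with admissible coefficients. If `s` holds, then the
coefficient that belongs to the pole of highest order in the first variable is positive. -/
def IsContribution (N D m : ℕ) (W : ℂ → (Fin m → ℂ) → ℂ → ℂ) (s : Prop) : Prop :=
  ∃ c : ℤˣ → Fin N → (Fin m → Label N) → ZetaPoly,
    (∀ a (j : Fin N) κ, Admissible D (j + order κ) (c a j κ)) ∧
    (s → ∀ (j : Fin N) κ, (j : ℕ) = D → IsLowest κ → 0 < MvPolynomial.constantCoeff (c 1 j κ)) ∧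
    ∀ q : ℂ, ‖q‖ < 1 → ∀ (z₀ : ℂ) (z : Fin m → ℂ), z₀ ^ 2 ≠ 1 → (∀ i, z i ^ 2 ≠ 1) → ∀ a,
      HasResidue (fun p => kernel (okuyamaY q) z₀ p * W q z p) (branch a)
        (∑ j, ∑ κ, zetaEval q (c a j κ) * basisFun (a, j) z₀ * basisProd κ z)

namespace IsContribution

variable {N D m : ℕ} {W W' : ℂ → (Fin m → ℂ) → ℂ → ℂ} {s s' : Prop}

theorem congr (h : IsContribution N D m W s) (hW : ∀ q z p, ‖q‖ < 1 → (∀ i, z i ^ 2 ≠ 1) → p ≠ 0 →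
    p ^ 2 ≠ 1 → W q z p = W' q z p) (hs : s' → s) : IsContribution N D m W' s' := by
  obtain ⟨c, h1, h2, h3⟩ := h
  refine ⟨c, h1, fun h => h2 (hs h), fun q hq z₀ z hz₀ hz a => ?_⟩
  refine (h3 q hq z₀ z hz₀ hz a).congr ?_
  filter_upwards [eventually_ne_branch (branch_sq a)] with p ⟨hp, hp1⟩
  rw [hW q z p hq hz hp hp1]

theorem zero (N D m : ℕ) : IsContribution N D m (fun _ _ _ => 0) False := by
  refine ⟨0, fun _ _ _ => Admissible.zero _ _, False.elim, fun q _ z₀ z _ _ a => ?_⟩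
  simpa using hasResidue_of_analyticAt (analyticAt_const (v := (0 : ℂ)) (x := branch a))

theorem add (h : IsContribution N D m W s) (h' : IsContribution N D m W' s') :
    IsContribution N D m (fun q z p => W q z p + W' q z p) (s ∨ s') := by
  obtain ⟨c, h1, h2, h3⟩ := h
  obtain ⟨c', h1', h2', h3'⟩ := h'
  refine ⟨fun a j κ => c a j κ + c' a j κ, fun a j κ => (h1 a j κ).add (h1' a j κ),
    fun hs j κ hj hκ => ?_, fun q hq z₀ z hz₀ hz a => ?_⟩
  · rw [map_add]
    rcases hs with hs | hs
    · exact add_pos_of_pos_of_nonneg (h2 hs j κ hj hκ) ((h1' 1 j κ).nonneg (by omega))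
    · exact add_pos_of_nonneg_of_pos ((h1 1 j κ).nonneg (by omega)) (h2' hs j κ hj hκ)
  · have := (h3 q hq z₀ z hz₀ hz a).add (h3' q hq z₀ z hz₀ hz a)
    simp only [← Finset.sum_add_distrib, ← add_mul, ← mul_add, ← map_add] at this
    exact this

theorem sum {ι : Type*} (t : Finset ι) {W : ι → ℂ → (Fin m → ℂ) → ℂ → ℂ} {s : ι → Prop}
    (h : ∀ i ∈ t, IsContribution N D m (W i) (s i)) :
    IsContribution N D m (fun q z p => ∑ i ∈ t, W i q z p) (∃ i ∈ t, s i) := by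
  classical
  induction t using Finset.induction_on with
  | empty => simpa using zero N D m
  | insert i t hi ih =>
    simp only [Finset.sum_insert hi, Finset.exists_mem_insert]
    exact (h i (Finset.mem_insert_self i t)).add
      (ih fun j hj => h j (Finset.mem_insert_of_mem hj))

theorem const_mul {r : ℚ} (hr : 0 < r) (h : IsContribution N D m W s) :
    IsContribution N D m (fun q z p => r * W q z p) s := by
  obtain ⟨c, h1, h2, h3⟩ := h
  refine ⟨fun a j κ => MvPolynomial.C r * c a j κ, fun a j κ => (h1 a j κ).C_mul hr.le,
    fun hs j κ hj hκ => ?_, fun q hq z₀ z hz₀ hz a => ?_⟩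
  · rw [map_mul, MvPolynomial.constantCoeff_C]
    exact mul_pos hr (h2 hs j κ hj hκ)
  · have := (h3 q hq z₀ z hz₀ hz a).const_mul (r : ℂ)
    simp only [Finset.mul_sum] at this
    simp only [map_mul, zetaEval_C, mul_assoc] at this ⊢
    simpa only [mul_left_comm] using this

end IsContribution

theorem evalSeries_X_pow_mul (q : ℂ) (j : ℕ) (φ : ZetaPoly⟦X⟧) :
    X ^ j * evalSeries q φ = evalSeries q (X ^ j * φ) := by
  rw [map_mul, map_pow, evalSeries_X]

theorem coeff_mk_mul_evalSeries (q : ℂ) (f : ℕ → ℂ) (φ : ZetaPoly⟦X⟧) {M N : ℕ} (h : M < N) :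
    coeff M (.mk f * evalSeries q φ) =
      ∑ j : Fin N, zetaEval q (coeff M (X ^ (j : ℕ) * φ)) * f j := by
  rw [coeff_mk_mul _ _ h]
  exact Finset.sum_congr rfl fun j _ => by
    rw [evalSeries_X_pow_mul, coeff_evalSeries, mul_comm]

theorem constantCoeff_coeff_zero_local_nonneg (a b c : ℤˣ) (k l : ℕ) :
    0 ≤ MvPolynomial.constantCoeff
      (coeff 0 (localSeries a b k * localSeries a c l * kernelSeries)) := by
  rw [coeff_zero_mul_eq, coeff_zero_mul_eq, coeff_zero_localSeries, coeff_zero_localSeries,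
    coeff_zero_kernelSeries, map_mul, map_mul, MvPolynomial.constantCoeff_C]
  split_ifs <;> norm_num

/-- Products of two basis differentials, one of them pulled back by the involution. -/
theorem isContribution_xi_mul_xi {N D D' m : ℕ} (hD : D' + 2 = D) (hN : D < N) (x y : Label N)
    {G : (Fin m → Label N) → ZetaPoly}
    (hG : ∀ κ, Admissible D' (x.2 + y.2 + order κ) (G κ)) :
    IsContribution N D m (fun q z p => ∑ κ, zetaEval q (G κ) * basisProd κ z *
        (basisFun x p * (basisFun y (sigma p) * deriv sigma p)))
      (x.1 = 1 ∧ y.1 = 1 ∧ (x.2 + y.2 : ℕ) = D' ∧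
        ∀ κ, IsLowest κ → 0 < MvPolynomial.constantCoeff (G κ)) := by
  have hmem := fun a => mul_mem (mul_mem (localSeries_mem a x.1 x.2) (localSeries_mem a y.1 y.2))
    kernelSeries_mem
  refine ⟨fun a j κ => G κ * coeff (x.2 + y.2 + 2)
    (X ^ (j : ℕ) * (localSeries a x.1 x.2 * localSeries a y.1 y.2 * kernelSeries)),
    fun a j κ => ?_, ?_, fun q hq z₀ z hz₀ hz a => ?_⟩
  · have h := (hG κ).mul (Admissible.coeff_X_pow_mul (hmem a)
      (constantCoeff_coeff_zero_local_nonneg _ _ _ _ _) (x.2 + y.2 + 2) j)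
    exact h.cancel (by omega)
  · rintro ⟨hx, hy, hxy, hpos⟩ j κ hj hκ
    rw [map_mul]
    refine mul_pos (hpos κ hκ) ?_
    rw [coeff_X_pow_mul', if_pos (by omega), show (x.2 + y.2 + 2 - j : ℕ) = 0 by omega,
      coeff_zero_mul_eq, coeff_zero_mul_eq, coeff_zero_localSeries, coeff_zero_localSeries,
      coeff_zero_kernelSeries, hx, hy]
    simp
  · have hterm : ∀ κ ∈ Finset.univ, HasResidue (fun p => zetaEval q (G κ) * basisProd κ z *
        (kernel (okuyamaY q) z₀ p * (basisFun x p * (basisFun y (sigma p) * deriv sigma p))))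
        (branch a) _ := fun κ _ => (hasResidue_kernel_xi_mul_xi hq a x.1 y.1 x.2 y.2 hz₀).const_mul
          (zetaEval q (G κ) * basisProd κ z)
    have h := HasResidue.sum Finset.univ hterm
    rw [Finset.sum_comm]
    convert h using 1
    · funext p
      rw [Finset.mul_sum]
      exact Finset.sum_congr rfl fun κ _ => by ring
    · refine Finset.sum_congr rfl fun κ _ => ?_
      by_cases h0 : G κ = 0
      · simp [h0]
      · have := (hG κ).le_of_ne_zero h0
        rw [coeff_mk_mul_evalSeries q _ _ (show (x.2 + y.2 + 2 : ℕ) < N by omega), Finset.mul_sum]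
        refine Finset.sum_congr rfl fun j _ => ?_
        rw [map_mul, basisFun]
        ring

/-! ### Splitting a tuple along a set of indices -/

/-- The entries of a tuple with indices in `I`, in increasing order of the indices. -/
def restrictTo {α : Type*} {m : ℕ} (κ : Fin m → α) (I : Finset (Fin m)) : Fin I.card → α :=
  fun i => κ (I.orderEmbOfFin rfl i)

section Split

variable {m : ℕ} (I : Finset (Fin m))

theorem prod_split {M : Type*} [CommMonoid M] (f : Fin m → M) :
    ∏ i, f i = (∏ i, f (I.orderEmbOfFin rfl i)) * ∏ i, f (Iᶜ.orderEmbOfFin rfl i) := by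
  rw [← (finSumEquivOfFinset (s := I) rfl rfl).prod_comp, Fintype.prod_sum_type]
  simp only [finSumEquivOfFinset_inl, finSumEquivOfFinset_inr]

theorem sum_split {ι R : Type*} [Fintype ι] [CommSemiring R]
    (f : (Fin I.card → ι) → R) (g : (Fin Iᶜ.card → ι) → R) :
    ∑ κ : Fin m → ι, f (restrictTo κ I) * g (restrictTo κ Iᶜ) = (∑ x, f x) * ∑ y, g y := by
  classical
  rw [Fintype.sum_mul_sum, ← Fintype.sum_prod_type']
  refine Fintype.sum_equiv (((finSumEquivOfFinset (s := I) rfl rfl).arrowCongr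
    (Equiv.refl ι)).symm.trans (Equiv.sumArrowEquivProdArrow _ _ ι)) _ _ fun κ => ?_
  congr 2

variable {N : ℕ}

theorem order_split (κ : Fin m → Label N) :
    order κ = order (restrictTo κ I) + order (restrictTo κ Iᶜ) := by
  classical
  simp only [order, restrictTo]
  rw [← (finSumEquivOfFinset (s := I) rfl rfl).sum_comp, Fintype.sum_sum_type]
  simp only [finSumEquivOfFinset_inl, finSumEquivOfFinset_inr]

theorem basisProd_split (κ : Fin m → Label N) (z : Fin m → ℂ) :
    basisProd κ z = basisProd (restrictTo κ I) (subtuple z I) *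
      basisProd (restrictTo κ Iᶜ) (subtuple z Iᶜ) :=
  prod_split I fun i => basisFun (κ i) (z i)

theorem orderEmbOfFin_singleton (i : Fin m) (j : Fin ({i} : Finset (Fin m)).card) :
    ({i} : Finset (Fin m)).orderEmbOfFin rfl j = i :=
  Finset.mem_singleton.1 (Finset.orderEmbOfFin_mem _ rfl j)

theorem sum_split_singleton {ι R : Type*} [Fintype ι] [CommSemiring R] (i : Fin m)
    (f : ι → R) (g : (Fin ({i}ᶜ : Finset (Fin m)).card → ι) → R) :
    ∑ κ : Fin m → ι, f (κ i) * g (restrictTo κ {i}ᶜ) = (∑ x, f x) * ∑ y, g y := by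
  have h0 : (0 : ℕ) < ({i} : Finset (Fin m)).card := by simp
  have h := sum_split {i} (fun x : Fin ({i} : Finset (Fin m)).card → ι => f (x ⟨0, h0⟩)) g
  simp only [restrictTo, orderEmbOfFin_singleton] at h
  refine h.trans ?_
  congr 1
  have : Unique (Fin ({i} : Finset (Fin m)).card) := inferInstanceAs (Unique (Fin 1))
  exact Fintype.sum_equiv (Equiv.funUnique _ ι) _ _ fun x =>
    congrArg (fun t => f (x t)) (Subsingleton.elim _ _)

theorem order_split_singleton (i : Fin m) (κ : Fin m → Label N) :
    order κ = (κ i).2 + order (restrictTo κ {i}ᶜ) := by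
  rw [order_split {i}]
  congr 1
  rw [order]
  simp only [restrictTo, orderEmbOfFin_singleton]
  simp

theorem basisProd_split_singleton (i : Fin m) (κ : Fin m → Label N) (z : Fin m → ℂ) :
    basisProd κ z = basisFun (κ i) (z i) *
      basisProd (restrictTo κ {i}ᶜ) (subtuple z {i}ᶜ) := by
  rw [basisProd_split {i}]
  congr 1
  rw [basisProd]
  simp only [restrictTo, subtuple, orderEmbOfFin_singleton]
  simp

theorem IsLowest.restrictTo {κ : Fin m → Label N} (h : IsLowest κ) :
    IsLowest (restrictTo κ I) := fun _ => h _

end Split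

/-! ### Contributions that contain the bidifferential -/

/-- Products of the bidifferential and a basis differential, made symmetric under the involution. -/
theorem isContribution_bidifferential_mul_xi {N D D' m : ℕ} (hD : D' + 1 = D) (hN : D < N)
    (x : Label N) (i : Fin m) {G : (Fin ({i}ᶜ : Finset (Fin m)).card → Label N) → ZetaPoly}
    (hG : ∀ κ, Admissible D' (x.2 + order κ) (G κ)) :
    IsContribution N D m (fun q z p => ∑ κ, zetaEval q (G κ) * basisProd κ (subtuple z {i}ᶜ) *
        (1 / (p - z i) ^ 2 * (basisFun x (sigma p) * deriv sigma p) +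
          basisFun x p * (1 / (sigma p - z i) ^ 2 * deriv sigma p)))
      (x.1 = 1 ∧ (x.2 : ℕ) = D' ∧
        ∀ κ, IsLowest κ → 0 < MvPolynomial.constantCoeff (G κ)) := by
  have hmem : ∀ a l, bidifferentialSeries l * (localSeries a x.1 x.2 * kernelSeries) ∈
    filteredSeries := fun a l =>
      mul_mem (bidifferentialSeries_mem l) (mul_mem (localSeries_mem a x.1 x.2) kernelSeries_mem)
  have hcoeff : ∀ a l, MvPolynomial.constantCoeff (coeff 0 (bidifferentialSeries l *
      (localSeries a x.1 x.2 * kernelSeries))) = (4 * l + 2) * (if x.1 = a then 1 / 4 else 0) := by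
    intro a l
    rw [coeff_zero_mul_eq, coeff_zero_mul_eq, coeff_zero_localSeries,
      coeff_zero_kernelSeries, coeff_zero_bidifferentialSeries, map_mul, map_mul,
      MvPolynomial.constantCoeff_C, MvPolynomial.constantCoeff_C]
    split_ifs <;> simp
  refine ⟨fun a j κ => (if (κ i).1 = a then coeff (x.2 + 1) (X ^ (j + (κ i).2 : ℕ) *
      (bidifferentialSeries (κ i).2 * (localSeries a x.1 x.2 * kernelSeries))) else 0) *
      G (restrictTo κ {i}ᶜ), fun a j κ => ?_, ?_, fun q hq z₀ z hz₀ hz a => ?_⟩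
  · have h1 : Admissible (x.2 + 1) (j + (κ i).2) (if (κ i).1 = a then coeff (x.2 + 1)
        (X ^ (j + (κ i).2 : ℕ) * (bidifferentialSeries (κ i).2 *
          (localSeries a x.1 x.2 * kernelSeries))) else 0) := by
      split_ifs
      · refine Admissible.coeff_X_pow_mul (hmem a _) ?_ _ _
        rw [hcoeff]
        split_ifs <;> positivity
      · exact Admissible.zero _ _
    have h := h1.mul (hG (restrictTo κ {i}ᶜ))
    have h2 := order_split_singleton i κ
    exact h.cancel (by omega)
  · rintro ⟨hx, hx', hpos⟩ j κ hj hκ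
    rw [map_mul]
    refine mul_pos ?_ (hpos _ (hκ.restrictTo _))
    rw [if_pos (hκ i).1, (hκ i).2, coeff_X_pow_mul', if_pos (by omega),
      show (x.2 + 1 - (j + 0) : ℕ) = 0 by omega, hcoeff, if_pos hx]
    norm_num
  · have hterm : ∀ κ ∈ Finset.univ, HasResidue (fun p => zetaEval q (G κ) *
        basisProd κ (subtuple z {i}ᶜ) * (kernel (okuyamaY q) z₀ p *
          (1 / (p - z i) ^ 2 * (basisFun x (sigma p) * deriv sigma p) +
          basisFun x p * (1 / (sigma p - z i) ^ 2 * deriv sigma p)))) (branch a) _ := fun κ _ =>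
      (hasResidue_kernel_bidifferential_mul_xi hq a x.1 x.2 hz₀ (hz i)).const_mul
          (zetaEval q (G κ) * basisProd κ (subtuple z {i}ᶜ))
    have h := HasResidue.sum Finset.univ hterm
    convert h using 1
    · funext p
      rw [Finset.mul_sum]
      exact Finset.sum_congr rfl fun κ _ => by ring
    · by_cases hG0 : ∀ κ, G κ = 0
      · simp [hG0]
      push Not at hG0
      obtain ⟨κ₀, hκ₀⟩ := hG0
      have hle := (hG κ₀).le_of_ne_zero hκ₀
      have hM : (x.2 + 1 : ℕ) < N := by omega
      rw [← Finset.sum_mul, coeff_mk_mul _ _ hM, mul_comm, Finset.sum_mul]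
      refine Finset.sum_congr rfl fun j _ => ?_
      set c : Fin N → ZetaPoly := fun l => coeff (x.2 + 1) (X ^ (j + l : ℕ) *
        (bidifferentialSeries l * (localSeries a x.1 x.2 * kernelSeries))) with hc
      have hcl : ∀ l : Fin N, coeff (x.2 + 1) (X ^ (l : ℕ) * evalSeries q (bidifferentialSeries l) *
          (X ^ (j : ℕ) * evalSeries q (localSeries a x.1 x.2 * kernelSeries))) =
          zetaEval q (c l) := by
        intro l
        rw [← coeff_evalSeries, ← evalSeries_X_pow_mul,
          map_mul (evalSeries q) (bidifferentialSeries l), pow_add]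
        congr 1
        ring
      have hsum : ∑ l : Fin N, xi (branch a) l (z i) * zetaEval q (c l) =
          ∑ y : Label N, zetaEval q (if y.1 = a then c y.2 else 0) * basisFun y (z i) := by
        rw [Fintype.sum_prod_type, Finset.sum_eq_single a]
        · exact Finset.sum_congr rfl fun l _ => by rw [if_pos rfl, mul_comm, basisFun]
        · intro b _ hb
          simp [hb]
        · exact fun h => absurd (Finset.mem_univ a) h
      rw [mul_left_comm, coeff_bidifferential_mul (q := q) _ _ hM]
      simp only [hcl]
      rw [hsum, mul_assoc, ← sum_split_singleton i
        (fun y => zetaEval q (if y.1 = a then c y.2 else 0) * basisFun y (z i))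
        (fun y => zetaEval q (G y) * basisProd y (subtuple z {i}ᶜ)), Finset.mul_sum]
      refine Finset.sum_congr rfl fun κ _ => ?_
      rw [map_mul, basisProd_split_singleton i, hc, basisFun]
      ring

/-- The product of two bidifferentials, made symmetric under the involution. -/
theorem isContribution_bidifferential_mul_bidifferential {N m : ℕ} (hN : 0 < N) (i i' : Fin m)
    (hi : ({i}ᶜ : Finset (Fin m)) = {i'}) :
    IsContribution N 0 m (fun _ z p =>
        1 / (p - z i) ^ 2 * (1 / (sigma p - z i') ^ 2 * deriv sigma p) +
          1 / (p - z i') ^ 2 * (1 / (sigma p - z i) ^ 2 * deriv sigma p)) True := by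
  classical
  refine ⟨fun a j κ => if (j : ℕ) = 0 ∧ ∀ i, κ i = (a, ⟨0, hN⟩) then MvPolynomial.C (1 / 2) else 0,
    fun a j κ => ?_, fun _ j κ hj hκ => ?_, fun q hq z₀ z hz₀ hz a => ?_⟩
  · beta_reduce
    split_ifs with h
    · have : order κ = 0 := Finset.sum_eq_zero fun i _ => by rw [h.2 i]
      rw [h.1, this]
      refine ⟨fun m hm => ?_, fun _ => by norm_num⟩
      simpa using C_mem_degLE zetaWeight 0 _ m hm
    · exact Admissible.zero _ _
  · beta_reduce
    rw [if_pos ⟨hj, fun i => Prod.ext (hκ i).1 (Fin.ext (hκ i).2)⟩]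
    norm_num
  · convert hasResidue_kernel_bidifferential_mul_bidifferential hq a hz₀ (hz i) (hz i') using 1
    rw [Finset.sum_eq_single (⟨0, hN⟩ : Fin N), Finset.sum_eq_single fun _ => (a, ⟨0, hN⟩)]
    · have hprod : basisProd (fun _ : Fin m => ((a, ⟨0, hN⟩) : Label N)) z =
          xi (branch a) 0 (z i) * xi (branch a) 0 (z i') := by
        rw [basisProd, ← Finset.prod_mul_prod_compl {i}, hi, Finset.prod_singleton,
          Finset.prod_singleton]
        rfl
      beta_reduce
      rw [if_pos ⟨rfl, fun _ => rfl⟩, hprod, zetaEval_C, basisFun]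
      norm_num
    · intro κ _ hκ
      beta_reduce
      rw [if_neg fun h => hκ (funext h.2), map_zero, zero_mul, zero_mul]
    · simp
    · intro j _ hj
      refine Finset.sum_eq_zero fun κ _ => ?_
      beta_reduce
      rw [if_neg fun h => hj (Fin.ext h.1), map_zero, zero_mul, zero_mul]
    · simp

/-- The bidifferential restricted to the graph of the involution. -/
theorem isContribution_bidifferential_diag {N : ℕ} (hN : 1 < N) :
    IsContribution N 1 0 (fun _ _ p => 1 / (p - sigma p) ^ 2 * deriv sigma p) True := by
  refine ⟨fun a j κ => coeff 1 (X ^ (j : ℕ) * (invAddFour * kernelSeries)), fun a j κ => ?_,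
    fun _ j κ hj hκ => ?_, fun q hq z₀ z hz₀ hz a => ?_⟩
  · have : order κ = 0 := rfl
    rw [this, add_zero]
    refine Admissible.coeff_X_pow_mul (mul_mem invAddFour_mem kernelSeries_mem) ?_ 1 j
    rw [coeff_zero_mul_eq, coeff_zero_invAddFour, coeff_zero_kernelSeries, map_mul,
      MvPolynomial.constantCoeff_C]
    norm_num
  · beta_reduce
    rw [coeff_X_pow_mul', if_pos hj.le, hj, Nat.sub_self, coeff_zero_mul_eq, coeff_zero_invAddFour,
      coeff_zero_kernelSeries, map_mul, MvPolynomial.constantCoeff_C]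
    norm_num
  · convert hasResidue_kernel_bidifferential_diag hq a hz₀ using 1
    rw [coeff_mk_mul_evalSeries q _ _ hN]
    refine Finset.sum_congr rfl fun j _ => ?_
    simp [basisProd, basisFun]

section Recursion

/-! ### Topological recursion -/

/-- The quadratic differential in `p` whose product with the kernel is integrated in the recursion
for `ω_{g,m+1}`. -/
def bracket (y : ℂ → ℂ) (g m : ℕ) (z : Fin m → ℂ) (p : ℂ) : ℂ :=
  (if 0 < g then
      omega y (g - 1) (m + 2) (Fin.cons p (Fin.cons (sigma p) z)) * deriv sigma p
    else 0) +
  ∑ g₁ : Fin (g + 1), ∑ I : Finset (Fin m),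
    if ((g₁ : ℕ) = 0 ∧ I = ∅) ∨ (g - (g₁ : ℕ) = 0 ∧ Iᶜ = ∅) then 0
    else
      omega y g₁ (I.card + 1) (Fin.cons p (subtuple z I)) *
        (omega y (g - g₁) (Iᶜ.card + 1) (Fin.cons (sigma p) (subtuple z Iᶜ)) * deriv sigma p)

theorem omega_succ (y : ℂ → ℂ) {g m : ℕ} (h : 2 ≤ 2 * g + m) (z : Fin (m + 1) → ℂ) :
    omega y g (m + 1) z = ∑ a ∈ ({1, -1} : Finset ℂ),
      residue (fun p => kernel y (z 0) p * bracket y g m (Fin.tail z) p) a := by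
  rw [omega, if_neg (by omega), if_neg (by omega)]
  rfl

theorem omega_zero_two (y : ℂ → ℂ) {k : ℕ} (hk : k = 1) (z : Fin (k + 1) → ℂ) :
    omega y 0 (k + 1) z = 1 / (z 0 - z (Fin.last k)) ^ 2 := by
  rw [omega, if_neg (by omega), if_pos ⟨rfl, hk⟩]

/-- The factor `ω_{g,|I|+1}(x, z_I)` of a term of the recursion. -/
def omegaOn (y : ℂ → ℂ) (g : ℕ) {m : ℕ} (x : ℂ) (z : Fin m → ℂ) (I : Finset (Fin m)) : ℂ :=
  omega y g (I.card + 1) (Fin.cons x (subtuple z I))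

theorem omegaOn_singleton (y : ℂ → ℂ) {m : ℕ} (x : ℂ) (z : Fin m → ℂ) (i : Fin m) :
    omegaOn y 0 x z {i} = 1 / (x - z i) ^ 2 := by
  rw [omegaOn, omega_zero_two y (Finset.card_singleton i), Fin.cons_zero]
  congr 3
  exact congrArg z (orderEmbOfFin_singleton i _)

/-- `ω_{g,n}` is a combination of products of basis differentials with admissible coefficients, which
are the same polynomials in the `q`-zeta values for all `q`. The coefficient of the product with a
pole of the highest order in the first variable, at `1`, and poles of the lowest order, at `1`, in
the other ones, is positive. -/
def HasExpansion (N g n : ℕ) : Prop :=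
  ∃ c : (Fin n → Label N) → ZetaPoly,
    (∀ κ, Admissible (3 * g + n - 3) (order κ) (c κ)) ∧
    (∀ κ, (∀ i : Fin n, (κ i).1 = 1 ∧ ((κ i).2 : ℕ) = if (i : ℕ) = 0 then 3 * g + n - 3 else 0) →
      0 < MvPolynomial.constantCoeff (c κ)) ∧
    ∀ q : ℂ, ‖q‖ < 1 → ∀ z : Fin n → ℂ, (∀ i, z i ^ 2 ≠ 1) →
      omega (okuyamaY q) g n z = ∑ κ, zetaEval q (c κ) * basisProd κ z

variable {N : ℕ}

theorem order_cons {n : ℕ} (x : Label N) (κ : Fin n → Label N) :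
    order (Fin.cons x κ : Fin (n + 1) → Label N) = x.2 + order κ := by
  simp [order, Fin.sum_univ_succ]

theorem basisProd_cons {n : ℕ} (x : Label N) (κ : Fin n → Label N) (p : ℂ) (z : Fin n → ℂ) :
    basisProd (Fin.cons x κ : Fin (n + 1) → Label N) (Fin.cons p z) =
      basisFun x p * basisProd κ z := by
  simp [basisProd, Fin.prod_univ_succ]

theorem sum_cons {ι R : Type*} [Fintype ι] [AddCommMonoid R] {n : ℕ} (f : (Fin (n + 1) → ι) → R) :
    ∑ κ, f κ = ∑ x, ∑ κ, f (Fin.cons x κ) := by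
  rw [← Fintype.sum_prod_type']
  exact (Fintype.sum_equiv (Fin.consEquiv fun _ => ι) _ _ fun _ => rfl).symm

theorem sum_branch (f : ℂ → ℂ) : ∑ a ∈ ({1, -1} : Finset ℂ), f a = ∑ a : ℤˣ, f (branch a) := by
  have h : (Finset.univ : Finset ℤˣ) = {1, -1} := rfl
  rw [h, Finset.sum_pair (by norm_num), Finset.sum_pair (by decide)]
  simp [branch]

theorem hasExpansion_of_isContribution {g m : ℕ} (h : 2 ≤ 2 * g + m)
    (hc : IsContribution N (3 * g + (m + 1) - 3) m (fun q z p => bracket (okuyamaY q) g m z p)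
      True) : HasExpansion N g (m + 1) := by
  obtain ⟨c, h1, h2, h3⟩ := hc
  refine ⟨fun κ => c (κ 0).1 (κ 0).2 (Fin.tail κ), fun κ => ?_, fun κ hκ => ?_,
    fun q hq z hz => ?_⟩
  · have := h1 (κ 0).1 (κ 0).2 (Fin.tail κ)
    rwa [← order_cons, Fin.cons_self_tail] at this
  · have h0 := hκ 0
    beta_reduce
    rw [h0.1]
    refine h2 trivial _ _ (by simpa using h0.2) fun i => ?_
    have hi := hκ i.succ
    rw [if_neg (by simp)] at hi
    exact hi
  · rw [omega_succ _ h, sum_branch, sum_cons, Fintype.sum_prod_type]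
    refine Finset.sum_congr rfl fun a _ => ?_
    rw [(h3 q hq (z 0) (Fin.tail z) (hz 0) (fun i => hz i.succ) a).residue_eq]
    refine Finset.sum_congr rfl fun j _ => Finset.sum_congr rfl fun κ _ => ?_
    conv_rhs => rw [← Fin.cons_self_tail z]
    rw [basisProd_cons, mul_assoc]
    simp only [Fin.tail_cons, Fin.cons_zero]

/-- The expansion of a factor of the recursion, with its first variable singled out. -/
theorem omegaOn_eq {m g : ℕ} {I : Finset (Fin m)} {c : (Fin (I.card + 1) → Label N) → ZetaPoly}
    {q : ℂ} (h : ∀ z : Fin (I.card + 1) → ℂ, (∀ i, z i ^ 2 ≠ 1) →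
      omega (okuyamaY q) g (I.card + 1) z = ∑ κ, zetaEval q (c κ) * basisProd κ z)
    {x : ℂ} (hx : x ^ 2 ≠ 1) {z : Fin m → ℂ} (hz : ∀ i, z i ^ 2 ≠ 1) :
    omegaOn (okuyamaY q) g x z I = ∑ y, basisFun y x * ∑ κ, zetaEval q (c (Fin.cons y κ)) *
      basisProd κ (subtuple z I) := by
  rw [omegaOn, h _ fun i => by
    refine Fin.cases ?_ (fun i => ?_) i
    · simpa using hx
    · exact hz _, sum_cons]
  refine Finset.sum_congr rfl fun y _ => ?_
  rw [Finset.mul_sum]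
  refine Finset.sum_congr rfl fun κ _ => ?_
  rw [basisProd_cons]
  ring

theorem sigma_sq_ne_one {p : ℂ} (hp1 : p ^ 2 ≠ 1) : sigma p ^ 2 ≠ 1 := by
  rwa [sigma, inv_pow, Ne, inv_eq_one]

theorem isContribution_omegaOn_mul_omegaOn {m g₁ g₂ D : ℕ} (hN : D < N) {I : Finset (Fin m)}
    (h₁ : HasExpansion N g₁ (I.card + 1)) (h₂ : HasExpansion N g₂ (Iᶜ.card + 1))
    (hD : 3 * g₁ + (I.card + 1) - 3 + (3 * g₂ + (Iᶜ.card + 1) - 3) + 2 = D) :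
    IsContribution N D m (fun q z p => omegaOn (okuyamaY q) g₁ p z I *
      (omegaOn (okuyamaY q) g₂ (sigma p) z Iᶜ * deriv sigma p)) False := by
  obtain ⟨c, hc, -, hcz⟩ := h₁
  obtain ⟨d, hd, -, hdz⟩ := h₂
  have h : ∀ xy : Label N × Label N, _ := fun xy =>
    isContribution_xi_mul_xi hD hN xy.1 xy.2 (m := m)
      (G := fun κ => c (Fin.cons xy.1 (restrictTo κ I)) * d (Fin.cons xy.2 (restrictTo κ Iᶜ)))
      (fun κ => by
        have := (hc (Fin.cons xy.1 (restrictTo κ I))).mul (hd (Fin.cons xy.2 (restrictTo κ Iᶜ)))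
        rw [order_cons, order_cons] at this
        have e := order_split I κ
        exact this.cancel (by omega))
  refine (IsContribution.sum Finset.univ fun xy _ => h xy).congr (fun q z p hq hz hp hp1 => ?_)
    False.elim
  rw [omegaOn_eq (hcz q hq) hp1 hz, omegaOn_eq (hdz q hq) (sigma_sq_ne_one hp1) hz,
    Fintype.sum_prod_type, Finset.sum_mul]
  refine Finset.sum_congr rfl fun x _ => ?_
  rw [Finset.sum_mul, Finset.mul_sum]
  refine Finset.sum_congr rfl fun y _ => ?_
  have e := sum_split I
    (fun κ => zetaEval q (c (Fin.cons x κ)) * basisProd κ (subtuple z I))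
    (fun κ => zetaEval q (d (Fin.cons y κ)) * basisProd κ (subtuple z Iᶜ))
  rw [← Finset.sum_mul]
  have e2 : ∑ κ : Fin m → Label N, zetaEval q (c (Fin.cons x (restrictTo κ I)) *
      d (Fin.cons y (restrictTo κ Iᶜ))) * basisProd κ z = _ :=
    (Finset.sum_congr rfl fun κ _ => by
      rw [map_mul, basisProd_split I]; ring).trans e
  rw [e2]
  ring

theorem isContribution_omegaOn_singleton {m g D : ℕ} (hN : D < N) (i : Fin m)
    (h : HasExpansion N g ((({i}ᶜ : Finset (Fin m))).card + 1))
    (hD : 3 * g + ((({i}ᶜ : Finset (Fin m))).card + 1) - 3 + 1 = D) :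
    IsContribution N D m (fun q z p => omegaOn (okuyamaY q) 0 p z {i} *
        (omegaOn (okuyamaY q) g (sigma p) z {i}ᶜ * deriv sigma p) +
      omegaOn (okuyamaY q) g p z {i}ᶜ *
        (omegaOn (okuyamaY q) 0 (sigma p) z {i} * deriv sigma p)) True := by
  obtain ⟨c, hc, hpos, hcz⟩ := h
  have h : ∀ x : Label N, _ := fun x =>
    isContribution_bidifferential_mul_xi hD hN x i (G := fun κ => c (Fin.cons x κ))
      (fun κ => by simpa only [order_cons] using hc (Fin.cons x κ))
  refine (IsContribution.sum Finset.univ fun x _ => h x).congr (fun q z p hq hz hp hp1 => ?_)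
    fun _ => ⟨(1, ⟨3 * g + ((({i}ᶜ : Finset (Fin m))).card + 1) - 3, by omega⟩),
      Finset.mem_univ _, rfl, rfl, fun κ hκ => hpos _ fun j => ?_⟩
  · rw [omegaOn_eq (hcz q hq) hp1 hz, omegaOn_eq (hcz q hq) (sigma_sq_ne_one hp1) hz,
      omegaOn_singleton, omegaOn_singleton, Finset.sum_mul, Finset.sum_mul, Finset.mul_sum,
      ← Finset.sum_add_distrib]
    refine Finset.sum_congr rfl fun x _ => ?_
    rw [← Finset.sum_mul]
    ring
  · refine Fin.cases ?_ (fun j => ?_) j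
    · simp
    · simpa using hκ j

/-- The terms of the recursion that belong to a splitting of the genus and of the variables, and to
the splitting with the two parts exchanged. -/
theorem isContribution_pair {g m g₁ g₂ : ℕ} (hg : g₁ + g₂ = g) (hst : 2 ≤ 2 * g + m)
    (hN : 3 * g + (m + 1) - 3 < N) (I : Finset (Fin m))
    (hI : ¬((g₁ = 0 ∧ I = ∅) ∨ (g₂ = 0 ∧ Iᶜ = ∅)))
    (ih : ∀ g' m', 2 ≤ 2 * g' + m' → 2 * g' + m' < 2 * g + m → g' ≤ g →
      HasExpansion N g' (m' + 1)) :
    IsContribution N (3 * g + (m + 1) - 3) m (fun q z p => omegaOn (okuyamaY q) g₁ p z I *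
        (omegaOn (okuyamaY q) g₂ (sigma p) z Iᶜ * deriv sigma p) +
      omegaOn (okuyamaY q) g₂ p z Iᶜ *
        (omegaOn (okuyamaY q) g₁ (sigma p) z I * deriv sigma p)) (g₁ = 0 ∧ I.card = 1) := by
  have hcard : I.card + Iᶜ.card = m := by
    rw [Finset.card_add_card_compl, Fintype.card_fin]
  rw [← Finset.card_eq_zero, ← Finset.card_eq_zero] at hI
  by_cases h1 : g₁ = 0 ∧ I.card = 1
  · obtain ⟨rfl, hI1⟩ := h1
    obtain ⟨i, rfl⟩ := Finset.card_eq_one.1 hI1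
    rw [zero_add] at hg
    subst hg
    by_cases h2 : g₂ = 0 ∧ ({i}ᶜ : Finset (Fin m)).card = 1
    · obtain ⟨rfl, hI2⟩ := h2
      obtain ⟨i', hi'⟩ := Finset.card_eq_one.1 hI2
      rw [show 3 * 0 + (m + 1) - 3 = 0 by omega] at hN ⊢
      refine (isContribution_bidifferential_mul_bidifferential hN i i' hi').congr
        (fun q z p hq hz hp hp1 => ?_) fun _ => trivial
      rw [hi', omegaOn_singleton, omegaOn_singleton, omegaOn_singleton, omegaOn_singleton]
    · exact (isContribution_omegaOn_singleton hN i (ih _ _ (by omega) (by omega) (by omega))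
        (by omega)).congr (fun _ _ _ _ _ _ _ => rfl) fun _ => trivial
  · by_cases h2 : g₂ = 0 ∧ Iᶜ.card = 1
    · obtain ⟨rfl, hI2⟩ := h2
      obtain ⟨i, hi⟩ := Finset.card_eq_one.1 hI2
      obtain rfl : I = {i}ᶜ := by rw [← hi, compl_compl]
      rw [add_zero] at hg
      subst hg
      refine (isContribution_omegaOn_singleton hN i (ih g₁ _ (by omega) (by omega) le_rfl)
        (by omega)).congr (fun q z p hq hz hp hp1 => ?_) fun _ => trivial
      rw [hi, add_comm]
    · have e1 := ih g₁ I.card (by omega) (by omega) (by omega)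
      have e2 := ih g₂ Iᶜ.card (by omega) (by omega) (by omega)
      refine ((isContribution_omegaOn_mul_omegaOn hN e1 e2 (by omega)).add
        (isContribution_omegaOn_mul_omegaOn (I := Iᶜ) hN e2 (by rwa [compl_compl])
          (by rw [compl_compl]; omega))).congr (fun q z p hq hz hp hp1 => ?_) fun h => (h1 h).elim
      rw [compl_compl]

/-- The sum over all splittings, made symmetric under the exchange of the two parts. -/
theorem isContribution_sum_pairs {g m : ℕ} (hst : 2 ≤ 2 * g + m) (hN : 3 * g + (m + 1) - 3 < N)
    (ih : ∀ g' m', 2 ≤ 2 * g' + m' → 2 * g' + m' < 2 * g + m → g' ≤ g →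
      HasExpansion N g' (m' + 1)) :
    IsContribution N (3 * g + (m + 1) - 3) m (fun q z p =>
      ∑ g₁ : Fin (g + 1), ∑ I : Finset (Fin m),
        if ((g₁ : ℕ) = 0 ∧ I = ∅) ∨ (g - (g₁ : ℕ) = 0 ∧ Iᶜ = ∅) then 0
        else omegaOn (okuyamaY q) g₁ p z I *
          (omegaOn (okuyamaY q) (g - g₁) (sigma p) z Iᶜ * deriv sigma p)) (1 ≤ m) := by
  have h : ∀ x : Fin (g + 1) × Finset (Fin m), IsContribution N (3 * g + (m + 1) - 3) m
      (fun q z p => if ((x.1 : ℕ) = 0 ∧ x.2 = ∅) ∨ (g - (x.1 : ℕ) = 0 ∧ x.2ᶜ = ∅) then 0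
        else omegaOn (okuyamaY q) x.1 p z x.2 *
          (omegaOn (okuyamaY q) (g - x.1) (sigma p) z x.2ᶜ * deriv sigma p) +
        omegaOn (okuyamaY q) (g - x.1) p z x.2ᶜ *
          (omegaOn (okuyamaY q) x.1 (sigma p) z x.2 * deriv sigma p))
      (((x.1 : ℕ) = 0 ∧ x.2.card = 1) ∧
        ¬(((x.1 : ℕ) = 0 ∧ x.2 = ∅) ∨ (g - (x.1 : ℕ) = 0 ∧ x.2ᶜ = ∅))) := by
    intro x
    by_cases hx : ((x.1 : ℕ) = 0 ∧ x.2 = ∅) ∨ (g - (x.1 : ℕ) = 0 ∧ x.2ᶜ = ∅)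
    · simp only [if_pos hx]
      exact (IsContribution.zero _ _ _).congr (fun _ _ _ _ _ _ _ => rfl) fun h => (h.2 hx).elim
    · simp only [if_neg hx]
      exact (isContribution_pair (by omega) hst hN x.2 hx ih).congr (fun _ _ _ _ _ _ _ => rfl)
        fun h => h.1
  refine ((IsContribution.sum Finset.univ fun x _ => h x).const_mul (r := 1 / 2)
    (by norm_num)).congr (fun q z p hq hz hp hp1 => ?_) fun hm => ?_
  · rw [← Fintype.sum_prod_type']
    set f : Fin (g + 1) × Finset (Fin m) → ℂ := fun x =>
      if ((x.1 : ℕ) = 0 ∧ x.2 = ∅) ∨ (g - (x.1 : ℕ) = 0 ∧ x.2ᶜ = ∅) then 0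
        else omegaOn (okuyamaY q) x.1 p z x.2 *
          (omegaOn (okuyamaY q) (g - x.1) (sigma p) z x.2ᶜ * deriv sigma p) with hf
    set e : Fin (g + 1) × Finset (Fin m) ≃ Fin (g + 1) × Finset (Fin m) :=
      Equiv.prodCongr Fin.revPerm ⟨compl, compl, compl_compl, compl_compl⟩ with he
    have hsum : ∑ x, f x = ∑ x, f (e x) := (Equiv.sum_comp e f).symm
    have : ∀ x, (if ((x.1 : ℕ) = 0 ∧ x.2 = ∅) ∨ (g - (x.1 : ℕ) = 0 ∧ x.2ᶜ = ∅) then 0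
        else omegaOn (okuyamaY q) x.1 p z x.2 *
          (omegaOn (okuyamaY q) (g - x.1) (sigma p) z x.2ᶜ * deriv sigma p) +
        omegaOn (okuyamaY q) (g - x.1) p z x.2ᶜ *
          (omegaOn (okuyamaY q) x.1 (sigma p) z x.2 * deriv sigma p)) = f x + f (e x) := by
      intro x
      have h1 : ((e x).1 : ℕ) = g - x.1 := by simp [he, Fin.val_rev]
      have h2 : (e x).2 = x.2ᶜ := rfl
      have h3 : g - (g - (x.1 : ℕ)) = x.1 := by omega
      simp only [hf]
      rw [h1, h2, h3, compl_compl]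
      by_cases hx : ((x.1 : ℕ) = 0 ∧ x.2 = ∅) ∨ (g - (x.1 : ℕ) = 0 ∧ x.2ᶜ = ∅)
      · rw [if_pos hx, if_pos hx, if_pos hx.symm, add_zero]
      · rw [if_neg hx, if_neg hx, if_neg fun h => hx h.symm]
    rw [Finset.sum_congr rfl fun x _ => this x, Finset.sum_add_distrib, ← hsum]
    push_cast
    ring
  · refine ⟨(0, {⟨0, hm⟩}), Finset.mem_univ _, ⟨by simp, by simp⟩, ?_⟩
    rintro (⟨-, h⟩ | ⟨h, h'⟩)
    · simp at h
    · have := Finset.card_add_card_compl ({⟨0, hm⟩} : Finset (Fin m))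
      rw [h', Finset.card_empty, Finset.card_singleton, Fintype.card_fin] at this
      simp at h
      omega

theorem isContribution_genus_reduction {g m : ℕ} (hg : 0 < g) (hN : 3 * g + (m + 1) - 3 < N)
    (ih : ∀ g' m', 2 ≤ 2 * g' + m' → 2 * g' + m' < 2 * g + m → g' ≤ g →
      HasExpansion N g' (m' + 1)) :
    IsContribution N (3 * g + (m + 1) - 3) m (fun q z p =>
      omega (okuyamaY q) (g - 1) (m + 2) (Fin.cons p (Fin.cons (sigma p) z)) * deriv sigma p)
      (m = 0) := by
  by_cases hst : 3 ≤ 2 * g + m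
  · obtain ⟨c, hc, hpos, hcz⟩ := ih (g - 1) (m + 1) (by omega) (by omega) (by omega)
    have h : ∀ xy : Label N × Label N, _ := fun xy =>
      isContribution_xi_mul_xi (D' := 3 * (g - 1) + (m + 1 + 1) - 3)
        (D := 3 * g + (m + 1) - 3) (by omega) hN xy.1 xy.2 (m := m)
        (G := fun κ => c (Fin.cons xy.1 (Fin.cons xy.2 κ)))
        (fun κ => by
          have := hc (Fin.cons xy.1 (Fin.cons xy.2 κ))
          rw [order_cons, order_cons] at this
          exact this.cancel (by omega))
    refine (IsContribution.sum Finset.univ fun xy _ => h xy).congr (fun q z p hq hz hp hp1 => ?_)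
      fun hm => ⟨((1, ⟨3 * (g - 1) + (m + 1 + 1) - 3, by omega⟩), (1, ⟨0, by omega⟩)),
        Finset.mem_univ _, rfl, rfl, rfl, fun κ _ => hpos _ fun i => ?_⟩
    · rw [hcz q hq _ fun i => by
        refine Fin.cases ?_ (fun i => Fin.cases ?_ (fun i => ?_) i) i
        · simpa using hp1
        · simpa using sigma_sq_ne_one hp1
        · simpa using hz i]
      rw [sum_cons, Finset.sum_mul, Fintype.sum_prod_type]
      refine Finset.sum_congr rfl fun x _ => ?_
      rw [sum_cons, Finset.sum_mul]
      refine Finset.sum_congr rfl fun y _ => ?_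
      rw [Finset.sum_mul]
      refine Finset.sum_congr rfl fun κ _ => ?_
      rw [basisProd_cons, basisProd_cons]
      ring
    · subst hm
      refine Fin.cases ?_ (fun i => ?_) i
      · simp
      · rw [Subsingleton.elim i 0]
        simp
  · obtain ⟨rfl, rfl⟩ : g = 1 ∧ m = 0 := by omega
    refine (isContribution_bidifferential_diag hN).congr (fun q z p hq hz hp hp1 => ?_)
      fun _ => trivial
    rw [Nat.sub_self, omega_zero_two _ rfl]
    rfl

/-- The stable correlation differentials of Okuyama's spectral curve, by induction on `2g - 2 + n`: the
bracket in the recursion is, after symmetrization, a sum of contributions. -/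
theorem hasExpansion {g m : ℕ} (hst : 2 ≤ 2 * g + m) (hN : 3 * g + (m + 1) - 3 < N) :
    HasExpansion N g (m + 1) := by
  induction hs : 2 * g + m using Nat.strong_induction_on generalizing g m with
  | _ s ih =>
    subst hs
    have ih' : ∀ g' m', 2 ≤ 2 * g' + m' → 2 * g' + m' < 2 * g + m → g' ≤ g →
        HasExpansion N g' (m' + 1) := fun g' m' h1 h2 h3 => ih _ h2 h1 (by omega) rfl
    refine hasExpansion_of_isContribution hst ?_
    have h2 := isContribution_sum_pairs hst hN ih'
    rcases Nat.eq_zero_or_pos g with hg | hg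
    · refine h2.congr (fun q z p _ _ _ _ => ?_) fun _ => by omega
      rw [bracket, if_neg (by omega), zero_add]
      rfl
    · refine ((isContribution_genus_reduction hg hN ih').add h2).congr
        (fun q z p _ _ _ _ => ?_) fun _ => by omega
      rw [bracket, if_pos hg]
      rfl

end Recursion

/-! ### Expansion at the origin -/

/-- The polynomial `∏_{1 ≤ i ≤ k} (X - i²) / (2k + 1)!`, whose value at `b²` is the coefficient of
`b z^(b - 1)` in the expansion of `xi 1 k` at the origin. -/
def volumePoly (k : ℕ) : Polynomial ℚ :=
  Polynomial.C ((2 * k + 1).factorial : ℚ)⁻¹ *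
    ∏ i ∈ Finset.range k, (Polynomial.X - Polynomial.C ((i + 1 : ℚ) ^ 2))

theorem choose_add_two (n m : ℕ) :
    ((n + 1).choose (m + 2) : ℚ) * ((m + 2) * (m + 1)) = (n + 1) * (n - m) * n.choose m := by
  have h1 : ((n + 1 : ℕ) : ℚ) * n.choose (m + 1) = (n + 1).choose (m + 2) * (m + 2 : ℕ) := by
    exact_mod_cast Nat.add_one_mul_choose_eq n (m + 1)
  have h2 : (n.choose (m + 1) : ℚ) * (m + 1) = n.choose m * (n - m) := by
    have h := Nat.choose_succ_right_eq n m
    rcases le_or_gt m n with hm | hm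
    · rw [← Nat.cast_sub hm]
      exact_mod_cast h
    · rw [Nat.choose_eq_zero_of_lt hm, Nat.choose_eq_zero_of_lt (by omega)]
      simp
  push_cast at h1
  linear_combination (-(m + 1 : ℚ)) * h1 + (n + 1 : ℚ) * h2

theorem mul_eval_volumePoly (k b : ℕ) :
    (b : ℚ) * (volumePoly k).eval ((b : ℚ) ^ 2) = (b + k).choose (2 * k + 1) := by
  induction k with
  | zero => simp [volumePoly]
  | succ k ih =>
    have h1 : (volumePoly (k + 1)).eval ((b : ℚ) ^ 2) * ((2 * k + 3) * (2 * k + 2)) =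
        (volumePoly k).eval ((b : ℚ) ^ 2) * ((b : ℚ) ^ 2 - (k + 1) ^ 2) := by
      rw [volumePoly, volumePoly, Finset.prod_range_succ, Polynomial.eval_mul, Polynomial.eval_mul,
        Polynomial.eval_mul, show 2 * (k + 1) + 1 = 2 * k + 1 + 1 + 1 by ring, Nat.factorial_succ,
        Nat.factorial_succ]
      have h0 : ((2 * k + 1).factorial : ℚ) ≠ 0 := by exact_mod_cast Nat.factorial_ne_zero _
      simp only [Polynomial.eval_C, Polynomial.eval_sub, Polynomial.eval_X]
      push_cast
      field_simp
      ring
    have h2 := choose_add_two (b + k) (2 * k + 1)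
    rw [← ih, show b + k + 1 = b + (k + 1) by ring, show 2 * k + 1 + 2 = 2 * (k + 1) + 1 by ring]
      at h2
    push_cast at h2
    have h3 : ((2 * k + 3) * (2 * k + 2) : ℚ) ≠ 0 := by positivity
    refine mul_right_cancel₀ h3 ?_
    linear_combination (b : ℚ) * h1 - h2

theorem hasSum_congr {β : Type*} {f g : β → ℂ} {s : ℂ} (h : ∀ b, f b = g b) :
    HasSum f s ↔ HasSum g s := by rw [funext h]

theorem hasSum_xi {a : ℂ} (ha : a ^ 2 = 1) (k : ℕ) {z : ℂ} (hz : ‖z‖ < 1) :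
    HasSum (fun b : ℕ+ => a ^ (b : ℕ) * Polynomial.aeval (((b : ℕ) : ℂ) ^ 2) (volumePoly k) *
      (((b : ℕ) : ℂ) * z ^ ((b : ℕ) - 1))) (xi a k z) := by
  have hna : ‖a‖ = 1 := by
    have := congrArg norm ha
    rw [norm_pow, norm_one] at this
    exact (pow_eq_one_iff_of_nonneg (norm_nonneg a) two_ne_zero).1 this
  have hw : ‖a * z‖ < 1 := by rwa [norm_mul, hna, one_mul]
  have h1 := ((hasSum_choose_mul_geometric_of_norm_lt_one (2 * k + 1) hw).mul_left
    (a * (a * z) ^ k))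
  have h2 : HasSum (fun n : ℕ => a * ((n + 1 + k).choose (2 * k + 1) : ℂ) * (a * z) ^ n)
      (xi a k z) := by
    have hinj : Function.Injective fun n : ℕ => n + k := add_left_injective k
    refine (hinj.hasSum_iff (fun n hn => ?_)).1 ?_
    · have : n < k := by
        by_contra h
        exact hn ⟨n - k, by simp; omega⟩
      rw [Nat.choose_eq_zero_of_lt (by omega)]
      simp
    · have h3 : xi a k z = a * (a * z) ^ k * (1 / (1 - a * z) ^ (2 * k + 1 + 1)) := by
        unfold xi
        ring
      rw [h3]
      refine (hasSum_congr fun n => ?_).1 h1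
      rw [Function.comp_apply, show n + k + 1 + k = n + (2 * k + 1) by ring, pow_add]
      ring
  refine (hasSum_congr fun b => ?_).1 (Equiv.pnatEquivNat.hasSum_iff.2 h2)
  obtain ⟨n, rfl⟩ := Equiv.pnatEquivNat.symm.surjective b
  have hn : ((Equiv.pnatEquivNat.symm n : ℕ+) : ℕ) = n + 1 := rfl
  rw [Function.comp_apply, Equiv.apply_symm_apply, hn, Nat.add_sub_cancel]
  have h3 : (((n + 1 : ℕ) : ℂ)) * Polynomial.aeval (((n + 1 : ℕ) : ℂ) ^ 2) (volumePoly k) =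
      ((n + 1 + k).choose (2 * k + 1) : ℂ) := by
    have h4 := congrArg (algebraMap ℚ ℂ) (mul_eval_volumePoly k (n + 1))
    rw [map_mul, ← Polynomial.aeval_algebraMap_apply_eq_algebraMap_eval, map_pow, map_natCast,
      map_natCast] at h4
    exact h4
  rw [← h3, pow_succ, mul_pow]
  ring

theorem hasSum_mul_prod {α β : Type*} {f : α → ℂ} {g : β → ℂ} {s t : ℂ} (hf : HasSum f s)
    (hg : HasSum g t) : HasSum (fun x : α × β => f x.1 * g x.2) (s * t) := by
  have h1 : Summable fun b => ‖f b‖ := summable_norm_iff.2 hf.summable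
  have h2 : Summable fun b => ‖g b‖ := summable_norm_iff.2 hg.summable
  exact hf.mul hg (summable_mul_of_summable_norm h1 h2)

theorem hasSum_mul_fibrewise {α β : Type*} {f g : α → ℂ} {G : α → β → ℂ} {s : ℂ}
    (hf : HasSum (fun c : α × β => f c.1 * G c.1 c.2) s) (hg : ∀ a, HasSum (G a) (g a)) :
    HasSum (fun a => f a * g a) s := by
  have h : ∀ a, HasSum (fun b => f a * G a b) (f a * g a) := fun a => (hg a).mul_left (f a)
  exact hf.prod_fiberwise h

theorem hasSum_pi {n : ℕ} {f : Fin n → ℕ+ → ℂ} {s : Fin n → ℂ} (h : ∀ i, HasSum (f i) (s i)) :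
    HasSum (fun b : Fin n → ℕ+ => ∏ i, f i (b i)) (∏ i, s i) := by
  induction n with
  | zero => simp
  | succ n ih =>
    have h1 : HasSum (fun b : Fin n → ℕ+ => ∏ i : Fin n, f i.succ (b i))
        (∏ i : Fin n, s i.succ) := ih fun i => h i.succ
    have h2 := hasSum_mul_prod (h 0) h1
    rw [Fin.prod_univ_succ]
    rw [← (Fin.consEquiv fun _ => ℕ+).hasSum_iff]
    refine (hasSum_congr fun x => ?_).1 h2
    simp [Fin.prod_univ_succ, Fin.consEquiv]

/-- If a double series of the form `∑ b xᵇ⁻¹ ∑ G b c` vanishes for all small `x`, then so do the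
inner sums. -/
theorem hasSum_fibre_zero {γ : Type*} {G : ℕ+ → γ → ℂ} {δ : ℝ} (hδ : 0 < δ)
    (h : ∀ x : ℂ, ‖x‖ < δ → HasSum (fun c : ℕ+ × γ =>
      (((c.1 : ℕ) : ℂ) * x ^ ((c.1 : ℕ) - 1)) * G c.1 c.2) 0) (b₀ : ℕ+) :
    HasSum (G b₀) 0 := by
  have hs : ∀ b, HasSum (G b) (∑' c, G b c) := by
    intro b
    refine Summable.hasSum ?_
    have hx : ‖((δ / 2 : ℝ) : ℂ)‖ < δ := by
      rw [Complex.norm_real, Real.norm_of_nonneg (by positivity)]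
      linarith
    have h1 : Summable fun c => (((b : ℕ) : ℂ) * ((δ / 2 : ℝ) : ℂ) ^ ((b : ℕ) - 1)) * G b c :=
      (h _ hx).summable.prod_factor b
    have h2 : ((δ / 2 : ℝ) : ℂ) ≠ 0 := by
      rw [Complex.ofReal_ne_zero]
      positivity
    have h3 : (((b : ℕ) : ℂ) * ((δ / 2 : ℝ) : ℂ) ^ ((b : ℕ) - 1)) ≠ 0 :=
      mul_ne_zero (by exact_mod_cast b.pos.ne') (pow_ne_zero _ h2)
    exact (summable_mul_left_iff h3).1 h1
  set F : ℕ+ → ℂ := fun b => ∑' c, G b c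
  have hpow : ∀ᶠ x : ℂ in 𝓝 0, HasSum (fun m : ℕ =>
      (((m + 1 : ℕ) : ℂ) * F (Equiv.pnatEquivNat.symm m)) * x ^ m) ((fun _ => 0 : ℂ → ℂ) x) := by
    filter_upwards [Metric.ball_mem_nhds (0 : ℂ) hδ] with x hx
    rw [mem_ball_zero_iff] at hx
    have h1 : HasSum (fun b : ℕ+ => (((b : ℕ) : ℂ) * x ^ ((b : ℕ) - 1)) * F b) 0 :=
      hasSum_mul_fibrewise (h x hx) hs
    have h2 : HasSum ((fun b : ℕ+ => (((b : ℕ) : ℂ) * x ^ ((b : ℕ) - 1)) * F b) ∘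
        Equiv.pnatEquivNat.symm) 0 := Equiv.pnatEquivNat.symm.hasSum_iff.2 h1
    refine (hasSum_congr fun m => ?_).1 h2
    have hm : ((Equiv.pnatEquivNat.symm m : ℕ+) : ℕ) = m + 1 := rfl
    rw [Function.comp_apply, hm, Nat.add_sub_cancel]
    ring
  have hT := (taylorSeries_of_hasSum hpow).2
  rw [taylorSeries_const, map_zero] at hT
  have h2 := congrArg (PowerSeries.coeff (Equiv.pnatEquivNat b₀)) hT
  rw [map_zero, PowerSeries.coeff_mk, Equiv.symm_apply_apply] at h2
  have h3 : F b₀ = 0 :=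
    (mul_eq_zero.1 h2.symm).resolve_left (Nat.cast_ne_zero.2 (Nat.succ_ne_zero _))
  exact h3 ▸ hs b₀

/-- The coefficients of an expansion at the origin are determined by its sum. -/
theorem eq_zero_of_hasSum_zero {n : ℕ} {N : (Fin n → ℕ+) → ℂ} {δ : ℝ} (hδ : 0 < δ)
    (h : ∀ z : Fin n → ℂ, (∀ i, ‖z i‖ < δ) →
      HasSum (fun b => N b * ∏ i, ((b i : ℕ) : ℂ) * z i ^ ((b i : ℕ) - 1)) 0) (b : Fin n → ℕ+) :
    N b = 0 := by
  induction n with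
  | zero =>
    have := (h 0 fun i => i.elim0).unique (hasSum_unique _)
    simp only [Finset.univ_eq_empty, Finset.prod_empty, mul_one] at this
    rw [this]
    exact congrArg N (Subsingleton.elim _ _)
  | succ n ih =>
    have hcons : ∀ (x : ℂ) (z : Fin n → ℂ), ‖x‖ < δ → (∀ i, ‖z i‖ < δ) →
        HasSum (fun c : ℕ+ × (Fin n → ℕ+) => (((c.1 : ℕ) : ℂ) * x ^ ((c.1 : ℕ) - 1)) *
          (N (Fin.cons c.1 c.2) * ∏ i, ((c.2 i : ℕ) : ℂ) * z i ^ ((c.2 i : ℕ) - 1))) 0 := by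
      intro x z hx hz
      have := h (Fin.cons x z) fun i => by
        refine Fin.cases ?_ (fun i => ?_) i
        · simpa using hx
        · simpa using hz i
      rw [← (Fin.consEquiv fun _ => ℕ+).hasSum_iff] at this
      refine (hasSum_congr fun c => ?_).1 this
      simp only [Function.comp_apply, Fin.consEquiv, Equiv.coe_fn_mk, Fin.prod_univ_succ,
        Fin.cons_zero, Fin.cons_succ]
      ring
    rw [← Fin.cons_self_tail b]
    exact ih (N := fun c => N (Fin.cons (b 0) c)) (fun z hz => hasSum_fibre_zero hδ
      (G := fun b₀ c => N (Fin.cons b₀ c) * ∏ i, ((c i : ℕ) : ℂ) * z i ^ ((c i : ℕ) - 1))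
      (fun x hx => hcons x z hx hz) (b 0)) (Fin.tail b)

theorem IsDiscreteVolume.unique {q : ℂ} {g n : ℕ} {N N' : (Fin n → ℕ+) → ℂ}
    (h : IsDiscreteVolume q g n N) (h' : IsDiscreteVolume q g n N') : N = N' := by
  obtain ⟨δ, hδ, hball⟩ := Metric.eventually_nhds_iff.1 (Filter.Eventually.and h h')
  funext b
  refine sub_eq_zero.1 (eq_zero_of_hasSum_zero (N := fun b => N b - N' b) hδ (fun z hz => ?_) b)
  obtain ⟨h1, h2⟩ := hball (y := z) (by
    rw [dist_pi_lt_iff hδ]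
    intro i
    simpa using hz i)
  have := h1.sub h2
  rw [sub_self] at this
  exact (hasSum_congr fun b => by ring).1 this

/-! ### The quasi-polynomial of an expansion -/

theorem prod_mem_degLE {σ ι : Type*} {w : σ → ℕ} {s : Finset ι} {f : ι → MvPolynomial σ ℚ}
    {d : ι → ℕ} (h : ∀ i ∈ s, f i ∈ degLE w (d i)) : ∏ i ∈ s, f i ∈ degLE w (∑ i ∈ s, d i) := by
  classical
  induction s using Finset.induction_on with
  | empty =>
    rw [Finset.prod_empty]
    exact map_one (MvPolynomial.C (σ := σ) (R := ℚ)) ▸ C_mem_degLE _ _ _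
  | insert i s hi ih =>
    rw [Finset.prod_insert hi, Finset.sum_insert hi]
    exact mul_mem_degLE (h i (Finset.mem_insert_self i s))
      (ih fun j hj => h j (Finset.mem_insert_of_mem hj))

theorem aeval_X_volumePoly_mem_degLE {n : ℕ} (i : Fin n) (k : ℕ) :
    Polynomial.aeval (MvPolynomial.X (Sum.inl i) : MvPolynomial (Fin n ⊕ ℕ) ℚ) (volumePoly k) ∈
      degLE (weight n) (2 * k) := by
  have h1 : ∏ j ∈ Finset.range k, (MvPolynomial.X (Sum.inl i) -
      MvPolynomial.C ((j + 1 : ℚ) ^ 2) : MvPolynomial (Fin n ⊕ ℕ) ℚ) ∈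
      degLE (weight n) (∑ _j ∈ Finset.range k, 2) :=
    prod_mem_degLE fun j _ => sub_mem (X_mem_degLE (weight n) (Sum.inl i)) (C_mem_degLE _ _ _)
  have h2 := mul_mem_degLE (C_mem_degLE (weight n) 0 ((2 * k + 1).factorial : ℚ)⁻¹) h1
  rw [Finset.sum_const, Finset.card_range, smul_eq_mul, zero_add, mul_comm k] at h2
  simpa [volumePoly, map_prod, MvPolynomial.algebraMap_eq] using h2

theorem rename_inr_mem_degLE {n d : ℕ} {c : ZetaPoly} (hc : c ∈ degLE zetaWeight d) :
    MvPolynomial.rename Sum.inr c ∈ degLE (weight n) (2 * d) := by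
  classical
  intro m hm
  rw [MvPolynomial.support_rename_of_injective Sum.inr_injective] at hm
  obtain ⟨m', hm', rfl⟩ := Finset.mem_image.1 hm
  have h1 := hc m' hm'
  rw [Finsupp.weight_apply, Finsupp.sum_mapDomain_index (by simp) fun b x y => add_smul x y _]
  rw [Finsupp.weight_apply] at h1
  refine le_trans (le_of_eq ?_) (Nat.mul_le_mul_left 2 h1)
  rw [Finsupp.sum, Finsupp.sum, Finset.mul_sum]
  refine Finset.sum_congr rfl fun k _ => ?_
  simp only [weight, zetaWeight, Sum.elim_inr, smul_eq_mul]
  ring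

/-- The quasi-polynomial that gives the coefficients at the origin of the expansion
`∑ κ, c κ * basisProd κ z`. -/
def expansionPoly {N n : ℕ} (c : (Fin n → Label N) → ZetaPoly) : QuasiPoly n := fun e =>
  ∑ κ, MvPolynomial.rename Sum.inr (c κ) *
    ∏ i, (MvPolynomial.C ((((κ i).1 : ℤ) : ℚ) ^ (e i).val) *
      Polynomial.aeval (MvPolynomial.X (Sum.inl i)) (volumePoly (κ i).2))

theorem expansionPoly_mem_degLE {N n D : ℕ} {c : (Fin n → Label N) → ZetaPoly}
    (hc : ∀ κ, Admissible D (order κ) (c κ)) (e : Fin n → ZMod 2) :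
    expansionPoly c e ∈ degLE (weight n) (2 * D) := by
  refine Submodule.sum_mem _ fun κ _ => ?_
  by_cases h0 : c κ = 0
  · rw [h0, map_zero, zero_mul]
    exact zero_mem _
  have hκ := (hc κ).le_of_ne_zero h0
  have h1 : c κ ∈ degLE zetaWeight (D - order κ) := fun m hm => by
    have := (hc κ).weight_le m hm
    omega
  have h2 : ∏ i, (MvPolynomial.C ((((κ i).1 : ℤ) : ℚ) ^ (e i).val) *
      Polynomial.aeval (MvPolynomial.X (Sum.inl i)) (volumePoly (κ i).2)) ∈
      degLE (weight n) (∑ i, (0 + 2 * ((κ i).2 : ℕ))) :=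
    prod_mem_degLE fun i _ => mul_mem_degLE (C_mem_degLE _ _ _) (aeval_X_volumePoly_mem_degLE i _)
  refine degLE_mono ?_ (mul_mem_degLE (rename_inr_mem_degLE h1) h2)
  simp only [zero_add, ← Finset.mul_sum]
  rw [order] at *
  omega

/-- The term of label `κ` in the coefficients at the origin. -/
def volumeTerm {N n : ℕ} (κ : Fin n → Label N) (b : Fin n → ℕ+) : ℂ :=
  ∏ i, branch (κ i).1 ^ (b i : ℕ) *
    Polynomial.aeval (((b i : ℕ) : ℂ) ^ 2) (volumePoly (κ i).2)

theorem eval_expansionPoly {N n : ℕ} (c : (Fin n → Label N) → ZetaPoly) (q : ℂ)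
    (b : Fin n → ℕ+) :
    (expansionPoly c).eval q b = ∑ κ, zetaEval q (c κ) * volumeTerm κ b := by
  rw [QuasiPoly.eval, expansionPoly, map_sum]
  refine Finset.sum_congr rfl fun κ _ => ?_
  rw [map_mul, map_prod, MvPolynomial.aeval_rename, volumeTerm]
  congr 1
  refine Finset.prod_congr rfl fun i _ => ?_
  have h : (((κ i).1 : ℤ) : ℂ) ^ ((b i : ℕ) % 2) = (((κ i).1 : ℤ) : ℂ) ^ (b i : ℕ) := by
    exact_mod_cast congrArg (fun u : ℤˣ => ((u : ℤ) : ℂ))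
      (Int.units_pow_eq_pow_mod_two (κ i).1 (b i)).symm
  rw [map_mul, ← Polynomial.aeval_algHom_apply, MvPolynomial.aeval_X, MvPolynomial.aeval_C,
    ZMod.val_natCast, map_pow, map_intCast, Sum.elim_inl, branch, h]

theorem hasSum_basisProd {N n : ℕ} (κ : Fin n → Label N) {z : Fin n → ℂ} (hz : ∀ i, ‖z i‖ < 1) :
    HasSum (fun b : Fin n → ℕ+ => volumeTerm κ b *
      ∏ i, ((b i : ℕ) : ℂ) * z i ^ ((b i : ℕ) - 1)) (basisProd κ z) := by
  have h := hasSum_pi fun i => hasSum_xi (branch_sq (κ i).1) ((κ i).2 : ℕ) (hz i)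
  refine (hasSum_congr fun b => ?_).1 h
  rw [volumeTerm, ← Finset.prod_mul_distrib]

theorem isDiscreteVolume_of_expansion {N n g : ℕ} {q : ℂ} {c : (Fin n → Label N) → ZetaPoly}
    (h : ∀ z, (∀ i, z i ^ 2 ≠ 1) →
      omega (okuyamaY q) g n z = ∑ κ, zetaEval q (c κ) * basisProd κ z) :
    IsDiscreteVolume q g n ((expansionPoly c).eval q) := by
  have h0 : ∀ᶠ z : Fin n → ℂ in 𝓝 0, ∀ i, ‖z i‖ < 1 := by
    filter_upwards [Metric.ball_mem_nhds (0 : Fin n → ℂ) one_pos] with z hz i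
    rw [mem_ball_zero_iff] at hz
    exact (norm_le_pi_norm z i).trans_lt hz
  filter_upwards [h0] with z hz
  rw [h z fun i hi => by
    have h1 := congrArg norm hi
    rw [norm_pow, norm_one] at h1
    exact (hz i).ne ((pow_eq_one_iff_of_nonneg (norm_nonneg _) two_ne_zero).1 h1)]
  have h1 := hasSum_sum (s := Finset.univ) fun κ _ =>
    (hasSum_basisProd κ hz).mul_left (zetaEval q (c κ))
  refine (hasSum_congr fun b => ?_).1 h1
  rw [eval_expansionPoly, Finset.sum_mul]
  exact Finset.sum_congr rfl fun κ _ => (mul_assoc _ _ _).symm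

theorem QuasiPoly.degree_le_iff {n d : ℕ} {P : QuasiPoly n} :
    P.degree ≤ (d : WithBot ℕ) ↔ ∀ e, P e ∈ degLE (weight n) d := by
  simp only [QuasiPoly.degree, MvPolynomial.weightedTotalDegree', Finset.sup_le_iff, mem_degLE,
    Finset.mem_univ, true_imp_iff, Nat.cast_withBot, WithBot.coe_le_coe]

/-! ### The lower bound for the degree -/

/-- The restriction of a polynomial to the line `b₁² = X`, `bᵢ² = 4` for `i > 1`, for the given
value of `q`. -/
def restrictLine (q : ℂ) (m : ℕ) : MvPolynomial (Fin (m + 1) ⊕ ℕ) ℚ →ₐ[ℚ] Polynomial ℂ :=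
  MvPolynomial.aeval (Sum.elim (fun i => if i = 0 then Polynomial.X else Polynomial.C 4)
    fun k => Polynomial.C (qZetaEven q (k + 1)))

theorem natDegree_restrictLine_le {q : ℂ} {m d : ℕ} {p : MvPolynomial (Fin (m + 1) ⊕ ℕ) ℚ}
    (hp : p ∈ degLE (weight (m + 1)) d) : (restrictLine q m p).natDegree ≤ d / 2 := by
  rw [restrictLine, MvPolynomial.aeval_def, MvPolynomial.eval₂_eq]
  refine Polynomial.natDegree_sum_le_of_forall_le _ _ fun s hs => ?_
  rw [Polynomial.algebraMap_apply]
  refine (Polynomial.natDegree_C_mul_le _ _).trans ((Polynomial.natDegree_prod_le _ _).trans ?_)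
  rw [Nat.le_div_iff_mul_le two_pos, Finset.sum_mul]
  have h1 : ∑ i ∈ s.support, s i * weight (m + 1) i ≤ d := by
    have h2 := hp s hs
    rwa [Finsupp.weight_apply] at h2
  refine le_trans (Finset.sum_le_sum fun i _ => ?_) h1
  · refine (Nat.mul_le_mul_right 2 Polynomial.natDegree_pow_le).trans ?_
    rw [mul_assoc]
    refine Nat.mul_le_mul_left _ ?_
    rcases i with i | k
    · rw [Sum.elim_inl, weight, Sum.elim_inl]
      split_ifs <;> simp
    · simp

/-- The points with `b₁ = 2 (t + 1)` and `b₂ = ⋯ = 2` lie on the line, and in the class of even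
tuples. -/
theorem eval_restrictLine {m : ℕ} (P : QuasiPoly (m + 1)) (q : ℂ) (t : ℕ) :
    (restrictLine q m (P 0)).eval (((2 * (t + 1) : ℕ) : ℂ) ^ 2) =
      P.eval q fun i => if i = 0 then 2 * t.succPNat else 2 := by
  have h1 : (fun i : Fin (m + 1) => (((if i = 0 then 2 * t.succPNat else 2 : ℕ+) : ℕ) : ZMod 2)) =
      0 := by
    funext i
    rw [Pi.zero_apply, ZMod.natCast_eq_zero_iff]
    split_ifs
    · exact Dvd.intro (t + 1) rfl
    · exact dvd_refl 2
  have h2 := MvPolynomial.comp_aeval_apply (R := ℚ) (p := P 0)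
    (Sum.elim (fun i : Fin (m + 1) => if i = 0 then Polynomial.X else Polynomial.C 4)
      fun k => Polynomial.C (qZetaEven q (k + 1)))
    ((Polynomial.aeval (((2 * (t + 1) : ℕ) : ℂ) ^ 2)).restrictScalars ℚ)
  rw [QuasiPoly.eval, h1, restrictLine]
  refine Eq.trans h2 (congrArg (fun f => MvPolynomial.aeval f (P 0)) (funext fun i => ?_))
  rcases i with i | k
  · by_cases hi : i = 0
    · simp [hi]
    · simp [hi]
      norm_num
  · simp

theorem restrictLine_eq_of_eval_eq {q : ℂ} {m : ℕ} {P P' : QuasiPoly (m + 1)}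
    (h : ∀ b, P.eval q b = P'.eval q b) : restrictLine q m (P 0) = restrictLine q m (P' 0) := by
  refine Polynomial.eq_of_infinite_eval_eq _ _ (Set.infinite_of_injective_forall_mem
    (f := fun t : ℕ => (((2 * (t + 1) : ℕ) : ℂ) ^ 2)) (fun s t hst => ?_) fun t => ?_)
  · have h0 : ((2 * (s + 1) : ℕ) : ℂ) ^ 2 = ((2 * (t + 1) : ℕ) : ℂ) ^ 2 := hst
    have h1 : (2 * (s + 1)) ^ 2 = (2 * (t + 1)) ^ 2 := by exact_mod_cast h0
    have := Nat.pow_left_injective two_ne_zero h1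
    omega
  · exact (eval_restrictLine P q t).trans ((h _).trans (eval_restrictLine P' q t).symm)

theorem eval_four_volumePoly_nonneg (k : ℕ) : 0 ≤ (volumePoly k).eval (4 : ℚ) := by
  have h := mul_eval_volumePoly k 2
  norm_num at h
  have : (0 : ℚ) ≤ ((2 + k).choose (2 * k + 1) : ℚ) := Nat.cast_nonneg _
  linarith

theorem natDegree_volumePoly_le (k : ℕ) : (volumePoly k).natDegree ≤ k := by
  refine (Polynomial.natDegree_C_mul_le _ _).trans ?_
  rw [Polynomial.natDegree_finsetProd_X_sub_C_eq_card, Finset.card_range]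

theorem coeff_volumePoly (k : ℕ) : (volumePoly k).coeff k = ((2 * k + 1).factorial : ℚ)⁻¹ := by
  have h1 : (∏ i ∈ Finset.range k, (Polynomial.X - Polynomial.C ((i + 1 : ℚ) ^ 2))).Monic :=
    Polynomial.monic_prod_of_monic _ _ fun i _ => Polynomial.monic_X_sub_C _
  have h2 := h1.coeff_natDegree
  rw [Polynomial.natDegree_finsetProd_X_sub_C_eq_card, Finset.card_range] at h2
  rw [volumePoly, Polynomial.coeff_C_mul, h2, mul_one]

theorem restrictLine_expansionPoly {N m : ℕ} (c : (Fin (m + 1) → Label N) → ZetaPoly) (q : ℂ) :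
    restrictLine q m (expansionPoly c 0) = ∑ κ, Polynomial.C (zetaEval q (c κ) *
      ((∏ i : Fin m, (volumePoly (κ i.succ).2).eval 4 : ℚ) : ℂ)) *
        (volumePoly (κ 0).2).map (algebraMap ℚ ℂ) := by
  rw [expansionPoly, map_sum]
  refine Finset.sum_congr rfl fun κ _ => ?_
  have h1 : restrictLine q m (MvPolynomial.rename Sum.inr (c κ)) =
      Polynomial.C (zetaEval q (c κ)) := by
    rw [restrictLine, MvPolynomial.aeval_rename]
    exact (MvPolynomial.comp_aeval_apply (fun k => qZetaEven q (k + 1))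
      (IsScalarTower.toAlgHom ℚ ℂ (Polynomial ℂ)) (c κ)).symm
  have h2 : ∀ i, restrictLine q m (MvPolynomial.C ((((κ i).1 : ℤ) : ℚ) ^ (ZMod.val (0 : ZMod 2))) *
      Polynomial.aeval (MvPolynomial.X (Sum.inl i)) (volumePoly (κ i).2)) =
      Polynomial.aeval (if i = 0 then Polynomial.X else Polynomial.C 4 : Polynomial ℂ)
        (volumePoly (κ i).2) := by
    intro i
    rw [ZMod.val_zero, pow_zero, map_one, one_mul, ← Polynomial.aeval_algHom_apply, restrictLine,
      MvPolynomial.aeval_X, Sum.elim_inl]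
  have h3 : ∀ k : ℕ, Polynomial.aeval (Polynomial.C 4 : Polynomial ℂ) (volumePoly k) =
      Polynomial.C (((volumePoly k).eval 4 : ℚ) : ℂ) := by
    intro k
    have h4 := Polynomial.aeval_algebraMap_apply_eq_algebraMap_eval (A := Polynomial ℂ) (4 : ℚ)
      (volumePoly k)
    rw [IsScalarTower.algebraMap_apply ℚ ℂ (Polynomial ℂ),
      IsScalarTower.algebraMap_apply ℚ ℂ (Polynomial ℂ)] at h4
    simpa using h4
  rw [map_mul, map_prod, h1, Polynomial.C_mul, mul_assoc]
  congr 1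
  simp only [Pi.zero_apply, h2]
  rw [Fin.prod_univ_succ, if_pos rfl, mul_comm, Polynomial.aeval_X_left_eq_map]
  congr 1
  simp [h3, Fin.succ_ne_zero]

/-- The leading coefficient along the line is a sum of non-negative rational numbers, one of which
is positive. -/
theorem coeff_restrictLine_ne_zero {m D : ℕ} {c : (Fin (m + 1) → Label (D + 1)) → ZetaPoly}
    (hc : ∀ κ, Admissible D (order κ) (c κ))
    (hpos : ∀ κ, (∀ i : Fin (m + 1), (κ i).1 = 1 ∧ ((κ i).2 : ℕ) = if (i : ℕ) = 0 then D else 0) →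
      0 < MvPolynomial.constantCoeff (c κ)) (q : ℂ) :
    (restrictLine q m (expansionPoly c 0)).coeff D ≠ 0 := by
  set v : (Fin (m + 1) → Label (D + 1)) → ℚ := fun κ => MvPolynomial.constantCoeff (c κ) *
    (∏ i : Fin m, (volumePoly (κ i.succ).2).eval 4) * (volumePoly (κ 0).2).coeff D with hv
  have hprod : ∀ κ : Fin (m + 1) → Label (D + 1),
      0 ≤ ∏ i : Fin m, (volumePoly (κ i.succ).2).eval 4 := fun κ =>
    Finset.prod_nonneg fun i _ => eval_four_volumePoly_nonneg _
  have hterm : ∀ κ, (zetaEval q (c κ) * ((∏ i : Fin m, (volumePoly (κ i.succ).2).eval 4 : ℚ) : ℂ)) *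
      algebraMap ℚ ℂ ((volumePoly (κ 0).2).coeff D) = ((v κ : ℚ) : ℂ) ∧ 0 ≤ v κ := by
    intro κ
    by_cases h0 : c κ = 0
    · simp [hv, h0]
    by_cases hD : ((κ 0).2 : ℕ) = D
    · have h1 : D ≤ order κ := by
        rw [order]
        exact hD.symm.le.trans
          (Finset.single_le_sum (f := fun i => ((κ i).2 : ℕ)) (fun _ _ => Nat.zero_le _)
            (Finset.mem_univ 0))
      -- All the degree is used up by `b₁`, so the coefficient is a number.
      have h2 : c κ = MvPolynomial.C (MvPolynomial.constantCoeff (c κ)) := by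
        ext s
        rw [MvPolynomial.coeff_C]
        split_ifs with hs
        · rw [← hs]
          rfl
        · by_contra h3
          have h4 := (hc κ).weight_le s (MvPolynomial.mem_support_iff.2 h3)
          obtain ⟨k, hk⟩ := Finsupp.ne_iff.1 (Ne.symm hs)
          have h5 := Finsupp.le_weight zetaWeight (Nat.succ_ne_zero k : zetaWeight k ≠ 0) s
          rw [Finsupp.zero_apply] at hk
          omega
      have h3 : zetaEval q (c κ) = ((MvPolynomial.constantCoeff (c κ) : ℚ) : ℂ) := by
        conv_lhs => rw [h2]
        exact zetaEval_C q _
      refine ⟨?_, mul_nonneg (mul_nonneg ((hc κ).nonneg h1) (hprod κ)) ?_⟩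
      · rw [h3, hv, eq_ratCast, Rat.cast_mul, Rat.cast_mul]
      · rw [hD, coeff_volumePoly]
        positivity
    · have h1 : (volumePoly (κ 0).2).coeff D = 0 :=
        Polynomial.coeff_eq_zero_of_natDegree_lt ((natDegree_volumePoly_le _).trans_lt (by
          have := (κ 0).2.isLt
          omega))
      simp [hv, h1]
  have hsum : (restrictLine q m (expansionPoly c 0)).coeff D = ((∑ κ, v κ : ℚ) : ℂ) := by
    rw [restrictLine_expansionPoly, Polynomial.finsetSum_coeff, Rat.cast_sum]
    refine Finset.sum_congr rfl fun κ _ => ?_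
    rw [Polynomial.coeff_C_mul, Polynomial.coeff_map, (hterm κ).1]
  rw [hsum, Rat.cast_ne_zero]
  refine (Finset.sum_pos' (fun κ _ => (hterm κ).2)
    ⟨fun i => (1, if (i : ℕ) = 0 then Fin.last D else 0), Finset.mem_univ _, ?_⟩).ne'
  refine mul_pos (mul_pos (hpos _ fun i => ⟨rfl, ?_⟩) (Finset.prod_pos fun i _ => ?_)) ?_
  · dsimp only
    split_ifs <;> simp
  · simp [volumePoly]
  · simp only [Fin.val_zero, if_true, Fin.val_last, coeff_volumePoly]
    positivity

theorem le_degree_of_coeff_ne_zero {m D : ℕ} {q : ℂ} {P P' : QuasiPoly (m + 1)}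
    (hP : (restrictLine q m (P 0)).coeff D ≠ 0) (h : ∀ b, P.eval q b = P'.eval q b) :
    ((2 * D : ℕ) : WithBot ℕ) ≤ P'.degree := by
  by_contra hlt
  rw [not_le] at hlt
  rw [restrictLine_eq_of_eval_eq h] at hP
  have h1 : ∀ s ∈ (P' 0).support, Finsupp.weight (weight (m + 1)) s < 2 * D := by
    intro s hs
    have h2 : ((Finsupp.weight (weight (m + 1)) s : ℕ) : WithBot ℕ) ≤
        MvPolynomial.weightedTotalDegree' (weight (m + 1)) (P' 0) :=
      Finset.le_sup (f := fun s => ((Finsupp.weight (weight (m + 1)) s : ℕ) : WithBot ℕ)) hs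
    have h3 : MvPolynomial.weightedTotalDegree' (weight (m + 1)) (P' 0) ≤ P'.degree :=
      Finset.le_sup (f := fun e => MvPolynomial.weightedTotalDegree' (weight (m + 1)) (P' e))
        (Finset.mem_univ 0)
    exact WithBot.coe_lt_coe.1 ((h2.trans h3).trans_lt hlt)
  have h2 : P' 0 ∈ degLE (weight (m + 1)) (2 * D - 1) := fun s hs => Nat.le_pred_of_lt (h1 s hs)
  rcases Nat.eq_zero_or_pos D with rfl | hD
  · have h3 : P' 0 = 0 := by
      rw [← MvPolynomial.support_eq_empty, Finset.eq_empty_iff_forall_notMem]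
      exact fun s hs => absurd (h1 s hs) (by omega)
    rw [h3, map_zero, Polynomial.coeff_zero] at hP
    exact hP rfl
  · exact hP (Polynomial.coeff_eq_zero_of_natDegree_lt
      ((natDegree_restrictLine_le h2).trans_lt (by omega)))

end Okuyama

end

open Okuyama in
/-- For `n ≥ 1` and `(g, n) ≠ (0, 1), (0, 2)`, the discrete volume `N^q_{g,n}` is given, for all
`|q| < 1`, by a quasi-polynomial in `b₁², …, bₙ²` over `ℚ[ζ_q(2), ζ_q(4), …]` of degree
`6g - 6 + 2n`, and for no `q` by one of smaller degree. -/
theorem theorem1p1 (g n : ℕ) (hn : 1 ≤ n) (h01 : (g, n) ≠ (0, 1)) (h02 : (g, n) ≠ (0, 2)) :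
    ∃ P : QuasiPoly n,
      P.degree = ((6 * g + 2 * n - 6 : ℕ) : WithBot ℕ) ∧
      ∀ q : ℂ, ‖q‖ < 1 →
        (∃ N : (Fin n → ℕ+) → ℂ, IsDiscreteVolume q g n N) ∧
        ∀ N : (Fin n → ℕ+) → ℂ, IsDiscreteVolume q g n N →
          (∀ b, N b = P.eval q b) ∧
          ∀ P' : QuasiPoly n, (∀ b, N b = P'.eval q b) →
            ((6 * g + 2 * n - 6 : ℕ) : WithBot ℕ) ≤ P'.degree := by
  obtain ⟨m, rfl⟩ : ∃ m, n = m + 1 := ⟨n - 1, by omega⟩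
  have hst : 2 ≤ 2 * g + m := by
    rcases g with _ | g
    · rcases m with _ | _ | m
      · exact absurd rfl h01
      · exact absurd rfl h02
      · omega
    · omega
  obtain ⟨c, hc, hpos, hexp⟩ := hasExpansion hst (Nat.lt_succ_self (3 * g + (m + 1) - 3))
  have hD : 6 * g + 2 * (m + 1) - 6 = 2 * (3 * g + (m + 1) - 3) := by omega
  rw [hD]
  have hle : ∀ q : ℂ, ∀ P' : QuasiPoly (m + 1), (∀ b, (expansionPoly c).eval q b = P'.eval q b) →
      ((2 * (3 * g + (m + 1) - 3) : ℕ) : WithBot ℕ) ≤ P'.degree := fun q P' h =>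
    le_degree_of_coeff_ne_zero (coeff_restrictLine_ne_zero hc hpos q) h
  refine ⟨expansionPoly c, le_antisymm ?_ (hle 0 _ fun _ => rfl), fun q hq => ?_⟩
  · exact QuasiPoly.degree_le_iff.2 (expansionPoly_mem_degLE hc)
  · have hvol := isDiscreteVolume_of_expansion (hexp q hq)
    refine ⟨⟨_, hvol⟩, fun N hN => ?_⟩
    rw [hN.unique hvol]
    exact ⟨fun _ => rfl, hle q⟩
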